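/- Let $G\in\mathbb{R}[x,y]$ be a nonconstant squarefree polynomial, let $C=\{(x,y)\in\mathbb{C}^2 : G(x,y)=0\}$ be the real plane algebraic curve it defines, and let $C_{\mathbb{R}}=\{(x,y)\in\mathbb{R}^2 : G(x,y)=0\}$ be its real point set. Assume that $C$ has no superfluous invisible components: if an irreducible factor $H\in\mathbb{R}[x,y]$ of $G$ has only finitely many real zeros, then $H$ equals $G$ up to a nonzero constant factor. (This holds in particular whenever $G$ is irreducible over $\mathbb{R}$.) Say that a map $f$ on a parameter set $S$ is a *generically one-to-one parametrization* of a set $M$ if $f(S)\subseteq M$, the set $M\setminus f(S)$ is finite, and $f$ is injective on $S\setminus E$ for some finite set $E$. Then the following three conditions are equivalent. 1. $C$ is *trigonometric*: there exist real trigonometric polynomials $X(t),Y(t)$ (finite real linear combinations of the functions $\sin(kt)$, $\cos(kt)$, $k\in\mathbb{Z}_{\ge 0}$) such that $t\mapsto(X(t),Y(t))$, $t\in[0,2\pi)$, is a generically one-to-one parametrization of $C_{\mathbb{R}}$. 2. There exist polynomials $P(\varphi),Q(\varphi)\in\mathbb{C}[\varphi]$ such that the map $\mathbb{C}^*\to\mathbb{C}^2$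 given by $$\varphi\longmapsto\bigl(P(\varphi)+\overline{P}(\varphi^{-1}),\;Q(\varphi)+\overline{Q}(\varphi^{-1})\bigr)$$ is a birational (i.e., generically one-to-one) parametrization of $C$. Here $\overline{P},\overline{Q}$ are obtained from $P,Q$ by complex conjugation of the coefficients. 3. $C$ is rational (that is, irreducible over $\mathbb{C}$ with function field isomorphic over $\mathbb{C}$ to $\mathbb{C}(s)$); $C$ has exactly two local branches at infinity, and these are distinct and interchanged by complex conjugation; and $C_{\mathbb{R}}$ is infinite. Here a local branch of $C$ at infinity is a point of the normalization of the projective closure of $C$ lying over the line at infinity, i.e., a valuation ring of the function field of $C$ that contains $\mathbb{C}$ but does not contain both coordinate functions $x$ and $y$. -/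

import Mathlib

noncomputable section

namespace TrigCurve

open MvPolynomial

/-- The `K`-points of the affine plane curve `G = 0`, where `G` has real coefficients and `K` is
`ℝ` (the real point set) or `ℂ` (the curve itself). -/
def points (K : Type) [Field K] [Algebra ℝ K] (G : MvPolynomial (Fin 2) ℝ) : Set (K × K) :=
  {p | aeval ![p.1, p.2] G = 0}

/-- `f`, restricted to `s`, is a generically one-to-one parametrization of the set `C`:
it maps `s` into `C`, reaches all but finitely many points of `C`, and becomes injective after
finitely many parameter values are removed. -/
structure IsGenericParam {α β : Type} (f : α → β) (s : Set α) (C : Set β) : Prop where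
  mapsTo : Set.MapsTo f s C
  cofinite : (C \ f '' s).Finite
  injOn : ∃ E : Set α, E.Finite ∧ Set.InjOn f (s \ E)

/-- Real trigonometric polynomials: finite real linear combinations of the functions
`t ↦ sin (k t)` and `t ↦ cos (k t)`, with `k` a nonnegative integer. -/
def IsTrigPoly (X : ℝ → ℝ) : Prop :=
  X ∈ Submodule.span ℝ
    (Set.range (fun (k : ℕ) (t : ℝ) => Real.sin (k * t)) ∪
      Set.range (fun (k : ℕ) (t : ℝ) => Real.cos (k * t)))

/-- The curve `G = 0` is trigonometric. -/
def IsTrigonometric (G : MvPolynomial (Fin 2) ℝ) : Prop :=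
  ∃ X Y : ℝ → ℝ, IsTrigPoly X ∧ IsTrigPoly Y ∧
    IsGenericParam (fun t => (X t, Y t)) (Set.Ico 0 (2 * Real.pi)) (points ℝ G)

/-- The value at `φ` of the Laurent polynomial `P(φ) + P̄(φ⁻¹)`, where `P̄` is obtained from `P` by
conjugating the coefficients. -/
def laurentEval (P : Polynomial ℂ) (φ : ℂ) : ℂ :=
  P.eval φ + (P.map (starRingEnd ℂ)).eval φ⁻¹

/-- The equation `G`, regarded as a polynomial with complex coefficients. -/
def complexify (G : MvPolynomial (Fin 2) ℝ) : MvPolynomial (Fin 2) ℂ :=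
  map (algebraMap ℝ ℂ) G

/-- The coordinate ring `ℂ[x, y] / (G)` of the complex curve `G = 0`. -/
abbrev CoordRing (G : MvPolynomial (Fin 2) ℝ) : Type :=
  MvPolynomial (Fin 2) ℂ ⧸ Ideal.span {complexify G}

/-- The function field of the complex curve `G = 0` (a field when the curve is irreducible). -/
abbrev FunctionField (G : MvPolynomial (Fin 2) ℝ) : Type :=
  FractionRing (CoordRing G)

/-- The coordinate functions `x` (`i = 0`) and `y` (`i = 1`) in the function field. -/
def coord (G : MvPolynomial (Fin 2) ℝ) (i : Fin 2) : FunctionField G :=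
  algebraMap (CoordRing G) (FunctionField G) (Ideal.Quotient.mk _ (X i))

/-- The complex curve `G = 0` is rational: it is irreducible and reduced, and it is birationally
equivalent to the projective line. -/
def IsRational (G : MvPolynomial (Fin 2) ℝ) : Prop :=
  IsDomain (CoordRing G) ∧ Nonempty (FunctionField G ≃ₐ[ℂ] RatFunc ℂ)

lemma map_conj_complexify (G : MvPolynomial (Fin 2) ℝ) :
    map (starRingEnd ℂ) (complexify G) = complexify G := by
  have h : (starRingEnd ℂ).comp (algebraMap ℝ ℂ) = algebraMap ℝ ℂ := by
    ext r; simp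
  rw [complexify, map_map, h]

/-- Complex conjugation on the coordinate ring: it conjugates the coefficients and fixes
`x` and `y`. -/
def conjCoordRing (G : MvPolynomial (Fin 2) ℝ) : CoordRing G ≃+* CoordRing G :=
  Ideal.quotientEquiv _ _ (mapEquiv (Fin 2) (starRingAut (R := ℂ))) (by
    rw [Ideal.map_span, Set.image_singleton]
    exact congrArg (fun H => Ideal.span {H}) (map_conj_complexify G).symm)

/-- Complex conjugation on the function field. -/
def conjFunctionField (G : MvPolynomial (Fin 2) ℝ) : FunctionField G ≃+* FunctionField G :=
  IsFractionRing.ringEquivOfRingEquiv (conjCoordRing G)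

section Branches

variable (G : MvPolynomial (Fin 2) ℝ) [IsDomain (CoordRing G)]

/-- The local branches at infinity of the irreducible curve `G = 0`, as points of the normalization
of its projective closure lying over the line at infinity. The points of the normalization are the
places of the function field, i.e. the valuation rings of the function field that contain `ℂ`
(apart from the function field itself); such a point lies over the affine plane exactly when both
`x` and `y` are regular there. The function field itself contains `x` and `y`, hence is not in
this set. -/
def branchesAtInfinity : Set (ValuationSubring (FunctionField G)) :=
  {V | (∀ c : ℂ, algebraMap ℂ (FunctionField G) c ∈ V) ∧ ¬ (coord G 0 ∈ V ∧ coord G 1 ∈ V)}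

/-- The complex conjugate of a place (conjugation is an involution, so its image and its
preimage under conjugation agree). -/
def conjPlace (V : ValuationSubring (FunctionField G)) : ValuationSubring (FunctionField G) :=
  V.comap (conjFunctionField G : FunctionField G →+* FunctionField G)

end Branches

/-- The curve `G = 0` is irreducible and has exactly two local branches at infinity, which are
distinct and complex conjugate to each other. -/
def HasTwoConjBranchesAtInfinity (G : MvPolynomial (Fin 2) ℝ) : Prop :=
  ∃ _ : IsDomain (CoordRing G), ∃ V : ValuationSubring (FunctionField G),
    V ≠ conjPlace G V ∧ branchesAtInfinity G = {V, conjPlace G V}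

end TrigCurve

end

/-!
The three conditions are linked by the substitution `φ = e^{it}`, under which real trigonometric
polynomials become the Laurent polynomials `P(φ) + P̄(φ⁻¹)`, that is, those fixed by the
conjugation `lconj`, which sends `φ` to `φ⁻¹` and conjugates the coefficients. The implications
proved are 2 → 1 → 3 → 2.

2 → 1 (`isTrigonometric_of_lpt`). The points with parameters `z` and `z̄⁻¹` are complex conjugate.
By generic injectivity a real point comes, up to finitely many exceptions, from `z = z̄⁻¹`, that
is, from the unit circle.

1 → 3. Since almost all real points are parametrized, an irreducible factor of `G` with infinitely
many real points shares infinitely many of them with the equation of the parametrized curve. The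
weak Bézout theorem `finite_common_zeros` and the assumption on invisible components show that `G`
is that equation (`irreducible_of_isGenericParam`), also over `ℂ` (`aeval_lp_eq_zero_iff`). The
function field therefore embeds into `ℂ(φ)`, and Lüroth's theorem makes the curve rational. Its
places at infinity are the restrictions of the places `φ = 0` and `φ = ∞`, which conjugation
interchanges (`exists_branchesAtInfinity_eq`). It has to be excluded that the two restrictions
agree. In that case there is a self-conjugate generator `w` of the function field whose only pole
is the place at infinity, so `x` and `y` are polynomials in `w`, while `w` is a continuous real
function on the unit circle, which cannot be generically injective (`not_subsingleton_branches`).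

3 → 2. Let `φ` be a generator of the function field with its zero at one place at infinity and its
pole at the other. The conjugation `σ` interchanges these places, so `σ φ = a / φ` with `a` real
(`exists_isGen_conj_eq`), and `a > 0` as there are infinitely many real points (`pos_of_conj_eq`).
After rescaling `a = 1`. The functions `x` and `y` have poles only at `φ = 0` and `φ = ∞` and are
fixed by `σ`, so they are Laurent polynomials in `φ` of the required form (`exists_lp_eq_coord`).
As `φ` is a rational function of `x` and `y`, the parametrization is generically bijective
(`isGenericParam_of_lev_eq_coord`).

Places are handled through `IsPlace.eq_of_valuation_lt_one` (a place of `k(r)` at which `r`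
vanishes is unique) and `exists_algebraMap_eq_of_forall_mem` (functions regular wherever an
integrally closed ring is regular lie in that ring).
-/

noncomputable section

namespace TrigCurve

/-! ### Common zeros of two plane curves -/

open Polynomial in
/-- Elimination: by Gauss's lemma, `F` and `H` are coprime over the fraction field of `K[X]` unless
`F` does not involve the outer variable at all. -/
lemma exists_C_mem_span_pair {K : Type*} [Field K] {F H : K[X][X]} (hF : Irreducible F)
    (h : ¬ F ∣ H) : ∃ d : K[X], d ≠ 0 ∧ ∃ a b : K[X][X], a * F + b * H = C d := by
  by_cases hdeg : F.natDegree = 0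
  -- here `F` is itself a constant of the outer polynomial ring
  · obtain ⟨f, rfl⟩ := natDegree_eq_zero.1 hdeg
    refine ⟨f, ?_, 1, 0, by simp⟩
    rintro rfl
    simp at hF
  have hprim : F.IsPrimitive := hF.isPrimitive hdeg
  have hirr := (hprim.irreducible_iff_irreducible_map_fraction_map (K := FractionRing K[X])).1 hF
  obtain ⟨a, b, hab⟩ : IsCoprime (F.map (algebraMap K[X] (FractionRing K[X])))
      (H.map (algebraMap K[X] (FractionRing K[X]))) := by
    refine hirr.coprime_iff_not_dvd.2 fun hd => h ?_
    exact hprim.dvd_of_fraction_map_dvd_fraction_map hd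
  -- clearing denominators in the Bézout relation
  obtain ⟨u, hu0, hu⟩ := IsLocalization.integerNormalization_spec (nonZeroDivisors K[X]) a
  obtain ⟨v, hv0, hv⟩ := IsLocalization.integerNormalization_spec (nonZeroDivisors K[X]) b
  set a' := IsLocalization.integerNormalization (nonZeroDivisors K[X]) a
  set b' := IsLocalization.integerNormalization (nonZeroDivisors K[X]) b
  refine ⟨u * v, mul_ne_zero (nonZeroDivisors.ne_zero hu0) (nonZeroDivisors.ne_zero hv0),
    C v * a', C u * b', ?_⟩
  apply map_injective _ (IsFractionRing.injective K[X] (FractionRing K[X]))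
  simp only [Polynomial.map_add, Polynomial.map_mul, hu, hv, map_C, Algebra.smul_def,
    map_mul]
  rw [Polynomial.algebraMap_apply]
  linear_combination (C (algebraMap K[X] (FractionRing K[X]) u)
    * C (algebraMap K[X] (FractionRing K[X]) v)) * hab

/-- A nonzero polynomial in the first coordinate alone vanishes at all common zeros. -/
lemma exists_aeval_fst_eq_zero {K : Type*} [Field K] {F H : MvPolynomial (Fin 2) K}
    (hF : Irreducible F) (h : ¬ F ∣ H) :
    ∃ d : Polynomial K, d ≠ 0 ∧ ∀ p : Fin 2 → K, MvPolynomial.aeval p F = 0 →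
      MvPolynomial.aeval p H = 0 → d.eval (p 0) = 0 := by
  let e := (Polynomial.Bivariate.equivMvPolynomial K).symm
  obtain ⟨d, hd, a, b, hab⟩ := exists_C_mem_span_pair (F := e F) (H := e H)
    ((MulEquiv.irreducible_iff e).2 hF) (by rwa [map_dvd_iff])
  refine ⟨d, hd, fun p hpF hpH => ?_⟩
  have key : ∀ q : MvPolynomial (Fin 2) K,
      (Polynomial.aevalAeval (p 0) (p 1)) (e q) = MvPolynomial.aeval p q := by
    intro q
    have : ((Polynomial.aevalAeval (p 0) (p 1)).comp e.toAlgHom) = MvPolynomial.aeval p := by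
      ext i
      fin_cases i <;> simp [e]
    exact congrArg (fun f => f q) this
  have := congrArg (Polynomial.aevalAeval (p 0) (p 1)) hab
  rw [map_add, map_mul, map_mul, key, key, hpF, hpH] at this
  simpa [Polynomial.aevalAeval_C, Polynomial.aeval_def, eq_comm] using this

/-- A weak form of Bézout's theorem: eliminating either coordinate leaves finitely many values for
the other. -/
lemma finite_common_zeros {K : Type*} [Field K] {F H : MvPolynomial (Fin 2) K}
    (hF : Irreducible F) (h : ¬ F ∣ H) :
    {p : K × K | MvPolynomial.aeval ![p.1, p.2] F = 0 ∧
      MvPolynomial.aeval ![p.1, p.2] H = 0}.Finite := by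
  classical
  obtain ⟨d, hd, hd'⟩ := exists_aeval_fst_eq_zero hF h
  let s := MvPolynomial.renameEquiv K (Equiv.swap (0 : Fin 2) 1)
  obtain ⟨d₂, hd₂, hd₂'⟩ := exists_aeval_fst_eq_zero (F := s F) (H := s H)
    ((MulEquiv.irreducible_iff s).2 hF) (by rwa [map_dvd_iff])
  refine ((d.roots.toFinset.finite_toSet).prod (d₂.roots.toFinset.finite_toSet)).subset ?_
  rintro ⟨x, y⟩ ⟨hpF, hpH⟩
  have hs : ∀ q, MvPolynomial.aeval ![y, x] (s q) = MvPolynomial.aeval ![x, y] q := by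
    intro q
    simp only [s, MvPolynomial.renameEquiv_apply, MvPolynomial.aeval_rename]
    congr 2
    ext i
    fin_cases i <;> simp
  have h1 := hd' ![x, y] hpF hpH
  have h2 := hd₂' ![y, x] (by rw [hs]; exact hpF) (by rw [hs]; exact hpH)
  simp only [Set.mem_prod, Finset.mem_coe, Multiset.mem_toFinset, Polynomial.mem_roots', ne_eq,
    Polynomial.IsRoot.def]
  exact ⟨⟨hd, h1⟩, ⟨hd₂, h2⟩⟩

section

/-! ### Laurent polynomials and their conjugation -/

open LaurentPolynomial
open scoped ComplexConjugate

section Eval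
variable {A : Type*} [CommRing A] [Algebra ℂ A]

/-- Substitution of a unit for the variable of a Laurent polynomial. -/
def lev (x : Aˣ) : ℂ[T;T⁻¹] →ₐ[ℂ] A :=
  { eval₂ (algebraMap ℂ A) x with
    commutes' := fun c => by
      change eval₂ (algebraMap ℂ A) x (algebraMap ℂ _ c) = _
      rw [← C_eq_algebraMap, eval₂_C] }

lemma lev_apply (x : Aˣ) (f : ℂ[T;T⁻¹]) : lev x f = eval₂ (algebraMap ℂ A) x f := rfl

@[simp] lemma lev_T (x : Aˣ) (n : ℤ) : lev x (T n) = ((x ^ n : Aˣ) : A) := by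
  simp [lev_apply]

lemma lev_toLaurent (x : Aˣ) (p : Polynomial ℂ) :
    lev x (Polynomial.toLaurent p) = Polynomial.aeval (x : A) p := by
  simp [lev_apply, Polynomial.aeval_def]

lemma lev_invert (x : Aˣ) (f : ℂ[T;T⁻¹]) : lev x (invert f) = lev x⁻¹ f := by
  induction f using LaurentPolynomial.induction_on' with
  | add p q hp hq => simp [hp, hq]
  | C_mul_T n a => simp [lev_apply]

end Eval

/-- The Laurent polynomial `P(T) + P̄(T⁻¹)`. -/
def lp (P : Polynomial ℂ) : ℂ[T;T⁻¹] :=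
  Polynomial.toLaurent P + invert (Polynomial.toLaurent (P.map (starRingEnd ℂ)))

lemma lev_lp {A : Type*} [CommRing A] [Algebra ℂ A] (x : Aˣ) (P : Polynomial ℂ) :
    lev x (lp P) = Polynomial.aeval (x : A) P +
      Polynomial.aeval ((x⁻¹ : Aˣ) : A) (P.map (starRingEnd ℂ)) := by
  rw [lp, map_add, lev_invert, lev_toLaurent, lev_toLaurent]

lemma lev_lp_eq_laurentEval (z : ℂˣ) (P : Polynomial ℂ) :
    lev z (lp P) = laurentEval P z := by
  simp [lev_lp, laurentEval, Polynomial.aeval_def]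

lemma lev_injective {A : Type*} [CommRing A] [Algebra ℂ A] {x : Aˣ}
    (hx : Transcendental ℂ (x : A)) : Function.Injective (lev x) := by
  rw [injective_iff_map_eq_zero]
  intro f hf
  obtain ⟨n, p, hp⟩ := exists_T_pow f
  have h0 : Polynomial.aeval (x : A) p = 0 := by
    rw [← lev_toLaurent, hp, map_mul, hf, zero_mul]
  have hp0 : p = 0 := (transcendental_iff.1 hx) p h0
  rw [hp0, map_zero] at hp
  exact ((isUnit_T n).mul_left_eq_zero).1 hp.symm

/-- A Laurent polynomial with infinitely many zeros vanishes. -/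
lemma finite_lev_eq_zero {f : ℂ[T;T⁻¹]} (hf : f ≠ 0) : {z : ℂˣ | lev z f = 0}.Finite := by
  classical
  obtain ⟨n, p, hp⟩ := exists_T_pow f
  have hp0 : p ≠ 0 := by
    rintro rfl
    rw [map_zero] at hp
    exact hf (((isUnit_T n).mul_left_eq_zero).1 hp.symm)
  refine Set.Finite.of_finite_image (f := ((↑) : ℂˣ → ℂ))
    ((p.roots.toFinset.finite_toSet).subset ?_) Units.val_injective.injOn
  rintro _ ⟨z, hz, rfl⟩
  have : lev z (Polynomial.toLaurent p) = 0 := by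
    rw [hp, map_mul, Set.mem_ofPred.1 hz, zero_mul]
  rw [lev_toLaurent] at this
  simpa [hp0, Polynomial.aeval_def] using this

/-- The conjugation `T ↦ T⁻¹` of Laurent polynomials which also conjugates the coefficients. On the
unit circle it is complex conjugation of the values. -/
def lconjHom : ℂ[T;T⁻¹] →+* ℂ[T;T⁻¹] :=
  eval₂ (LaurentPolynomial.C.comp (starRingEnd ℂ)) (isUnit_T (-1)).unit

lemma lconjHom_C_mul_T (c : ℂ) (n : ℤ) : lconjHom (C c * T n) = C (conj c) * T (-n) := by
  have h : (((isUnit_T (R := ℂ) (-1)).unit ^ n : ℂ[T;T⁻¹]ˣ) : ℂ[T;T⁻¹]) = T (-n) := by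
    cases n with
    | ofNat n => simp [T_pow]
    | negSucc n =>
      rw [zpow_negSucc]
      refine Units.inv_eq_of_mul_eq_one_right ?_
      rw [Units.val_pow_eq_pow_val, IsUnit.unit_spec, T_pow, ← T_add,
        show ((n + 1 : ℕ) : ℤ) * -1 + -Int.negSucc n = 0 by omega, T_zero]
  rw [lconjHom, eval₂_C_mul_T, h, RingHom.comp_apply]

lemma lconjHom_lconjHom (f : ℂ[T;T⁻¹]) : lconjHom (lconjHom f) = f := by
  induction f using LaurentPolynomial.induction_on' with
  | add p q hp hq => simp [hp, hq]
  | C_mul_T n a => simp only [lconjHom_C_mul_T]; simp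

/-- `lconjHom` as an automorphism. -/
def lconj : ℂ[T;T⁻¹] ≃+* ℂ[T;T⁻¹] :=
  RingEquiv.ofRingHom lconjHom lconjHom (RingHom.ext lconjHom_lconjHom)
    (RingHom.ext lconjHom_lconjHom)

lemma lconj_C_mul_T (c : ℂ) (n : ℤ) : lconj (C c * T n) = C (conj c) * T (-n) :=
  lconjHom_C_mul_T c n

lemma lconj_C (c : ℂ) : lconj (C c) = C (conj c) := by
  simpa using lconj_C_mul_T c 0

lemma lconj_T (n : ℤ) : lconj (T n) = T (-n) := by
  simpa using lconj_C_mul_T 1 n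

lemma lconj_toLaurent (p : Polynomial ℂ) :
    lconj (Polynomial.toLaurent p) = invert (Polynomial.toLaurent (p.map (starRingEnd ℂ))) := by
  induction p using Polynomial.induction_on' with
  | add p q hp hq => simp [hp, hq]
  | monomial n a => simp [lconj_C, lconj_T]

lemma lconj_invert (f : ℂ[T;T⁻¹]) : lconj (invert f) = invert (lconj f) := by
  induction f using LaurentPolynomial.induction_on' with
  | add p q hp hq => simp [hp, hq]
  | C_mul_T n a => simp [lconj_C, lconj_T]

lemma map_conj_conj (p : Polynomial ℂ) :
    (p.map (starRingEnd ℂ)).map (starRingEnd ℂ) = p := by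
  ext; simp

lemma lconj_lp (P : Polynomial ℂ) : lconj (lp P) = lp P := by
  rw [lp, map_add, lconj_invert, lconj_toLaurent, lconj_toLaurent, map_conj_conj,
    show ∀ f : ℂ[T;T⁻¹], invert (invert f) = f from fun f => involutive_invert f, add_comm]

lemma exists_toLaurent_add_invert (f : ℂ[T;T⁻¹]) :
    ∃ p q : Polynomial ℂ, f = Polynomial.toLaurent p + invert (Polynomial.toLaurent q) := by
  induction f using LaurentPolynomial.induction_on' with
  | add f g hf hg =>
    obtain ⟨p, q, rfl⟩ := hf
    obtain ⟨p', q', rfl⟩ := hg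
    exact ⟨p + p', q + q', by simp only [map_add]; ring⟩
  | C_mul_T n a =>
    cases n with
    | ofNat n => exact ⟨Polynomial.monomial n a, 0, by simp⟩
    | negSucc n =>
      exact ⟨0, Polynomial.monomial (n + 1) a, by
        rw [map_zero, zero_add, Polynomial.toLaurent_C_mul_T]; simp [Int.negSucc_eq]⟩

/-- The Laurent polynomials fixed by conjugation are those of the form `P(T) + P̄(T⁻¹)`; the
polynomial `P` arises by averaging an arbitrary decomposition with its conjugate. -/
lemma exists_eq_lp {f : ℂ[T;T⁻¹]} (hf : lconj f = f) : ∃ P, f = lp P := by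
  obtain ⟨p, q, hpq⟩ := exists_toLaurent_add_invert f
  have h2 : f = C (1 / 2) * (f + lconj f) := by
    rw [hf, ← two_mul, ← mul_assoc, show (2 : ℂ[T;T⁻¹]) = C 2 from (map_ofNat C 2).symm, ← map_mul]
    norm_num
  refine ⟨Polynomial.C (1 / 2) * (p + q.map (starRingEnd ℂ)), ?_⟩
  have hc : (starRingEnd ℂ) (1 / 2) = 1 / 2 := by simp [map_ofNat]
  rw [h2, hpq, map_add lconj, lconj_invert, lconj_toLaurent, lconj_toLaurent,
    show ∀ f : ℂ[T;T⁻¹], invert (invert f) = f from fun f => involutive_invert f, lp]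
  simp only [map_add, map_mul, Polynomial.map_mul, Polynomial.map_add, Polynomial.map_C, hc,
    Polynomial.toLaurent_C, invert_C, map_conj_conj]
  ring

/-! ### Trigonometric polynomials on the unit circle -/

/-- The inversion `z ↦ z̄⁻¹` in the unit circle. -/
def circleInv (z : ℂˣ) : ℂˣ := (Units.map (starRingEnd ℂ).toMonoidHom z)⁻¹

lemma circleInv_val (z : ℂˣ) : (circleInv z : ℂ) = (conj (z : ℂ))⁻¹ := by
  simp [circleInv]

lemma lev_lconj (z : ℂˣ) (f : ℂ[T;T⁻¹]) : lev z (lconj f) = conj (lev (circleInv z) f) := by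
  induction f using LaurentPolynomial.induction_on' with
  | add p q hp hq => simp [hp, hq]
  | C_mul_T n a =>
    rw [lconj_C_mul_T, lev_apply, lev_apply, eval₂_C_mul_T, eval₂_C_mul_T, map_mul]
    congr 1
    simp [circleInv_val]

/-- The point `e^{it}` of the unit circle. -/
def cis (t : ℝ) : ℂˣ := Units.mk0 (Complex.exp (t * Complex.I)) (Complex.exp_ne_zero _)

lemma cis_val (t : ℝ) : (cis t : ℂ) = Complex.exp (t * Complex.I) := rfl

lemma circleInv_cis (t : ℝ) : circleInv (cis t) = cis t := by
  ext
  rw [circleInv_val, cis_val, ← Complex.exp_conj, ← Complex.exp_neg]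
  simp

lemma lev_cis_real {f : ℂ[T;T⁻¹]} (hf : lconj f = f) (t : ℝ) :
    (((lev (cis t) f).re : ℝ) : ℂ) = lev (cis t) f := by
  rw [← Complex.conj_eq_iff_re]
  conv_rhs => rw [← hf, lev_lconj, circleInv_cis]

lemma continuous_lev_cis (f : ℂ[T;T⁻¹]) : Continuous fun t => lev (cis t) f := by
  obtain ⟨p, q, rfl⟩ := exists_toLaurent_add_invert f
  simp only [map_add, lev_invert, lev_toLaurent, Units.val_inv_eq_inv_val, cis_val,
    ← Complex.exp_neg]
  fun_prop

lemma cis_injOn : Set.InjOn cis (Set.Ico 0 (2 * Real.pi)) := by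
  intro s hs t ht h
  have h' : Complex.exp (s * Complex.I) = Complex.exp (t * Complex.I) := congrArg Units.val h
  obtain ⟨n, hn⟩ := Complex.exp_eq_exp_iff_exists_int.1 h'
  have hst : s = t + n * (2 * Real.pi) := by
    have := congrArg Complex.im hn
    simpa using this
  have hpi := Real.pi_pos
  have h1 : (n : ℝ) < 1 := by
    by_contra hc
    nlinarith [hs.2, ht.1, not_lt.1 hc]
  have h2 : (-1 : ℝ) < n := by
    by_contra hc
    nlinarith [hs.1, ht.2, not_lt.1 hc]
  have : n = 0 := by
    have h1' : n < 1 := by exact_mod_cast h1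
    have h2' : -1 < n := by exact_mod_cast h2
    omega
  rw [hst, this]; simp

/-- The fixed points of the inversion form the unit circle. -/
lemma exists_cis {z : ℂˣ} (hz : circleInv z = z) : ∃ t ∈ Set.Ico 0 (2 * Real.pi), cis t = z := by
  have hn : ‖(z : ℂ)‖ = 1 := by
    have h := congrArg Units.val hz
    rw [circleInv_val] at h
    have h' := congrArg norm h
    rw [norm_inv, RCLike.norm_conj] at h'
    have hpos : 0 < ‖(z : ℂ)‖ := norm_pos_iff.2 z.ne_zero
    field_simp at h'
    nlinarith
  have h0 : (z : ℂ) = Complex.exp (Complex.arg z * Complex.I) := by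
    conv_lhs => rw [← Complex.norm_mul_exp_arg_mul_I (z : ℂ), hn]
    simp
  by_cases ha : 0 ≤ Complex.arg z
  · exact ⟨Complex.arg z, ⟨ha, by linarith [Complex.arg_le_pi z, Real.pi_pos]⟩, Units.ext h0.symm⟩
  · refine ⟨Complex.arg z + 2 * Real.pi, ⟨by linarith [Complex.neg_pi_lt_arg z, Real.pi_pos],
      by linarith⟩, Units.ext ?_⟩
    rw [cis_val]
    push_cast
    rw [add_mul, Complex.exp_add, Complex.exp_two_pi_mul_I, mul_one]
    exact h0.symm

/-- Real trigonometric polynomials are the restrictions to the unit circle of the Laurent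
polynomials `P(T) + P̄(T⁻¹)`. -/
lemma IsTrigPoly.exists_lp {X : ℝ → ℝ} (hX : IsTrigPoly X) :
    ∃ P, ∀ t, (X t : ℂ) = lev (cis t) (lp P) := by
  have key : ∀ (k : ℕ) (c : ℂ) (t : ℝ), lev (cis t) (lp (Polynomial.monomial k c)) =
      c * Complex.exp ((k * t : ℝ) * Complex.I) +
        conj c * Complex.exp (-(k * t : ℝ) * Complex.I) := by
    intro k c t
    simp only [lev_lp, Polynomial.map_monomial, Polynomial.aeval_monomial, Algebra.algebraMap_self,
      RingHom.id_apply, Units.val_inv_eq_inv_val, cis_val, ← Complex.exp_neg, ← Complex.exp_nat_mul]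
    push_cast
    ring_nf
  induction hX using Submodule.span_induction with
  | mem X hX =>
    rcases hX with ⟨k, rfl⟩ | ⟨k, rfl⟩
    · refine ⟨Polynomial.monomial k (-Complex.I / 2), fun t => ?_⟩
      rw [key, Complex.ofReal_sin, Complex.sin]
      simp only [map_div₀, map_neg, Complex.conj_I, map_ofNat]
      push_cast
      ring
    · refine ⟨Polynomial.monomial k (1 / 2), fun t => ?_⟩
      rw [key, Complex.ofReal_cos, Complex.cos]
      simp only [map_div₀, map_one, map_ofNat]
      push_cast
      ring
  | zero => exact ⟨0, fun t => by simp [lp]⟩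
  | add X Y _ _ hX hY =>
    obtain ⟨P, hP⟩ := hX
    obtain ⟨Q, hQ⟩ := hY
    refine ⟨P + Q, fun t => ?_⟩
    rw [show lp (P + Q) = lp P + lp Q by simp [lp]; ring, map_add, ← hP, ← hQ]
    simp
  | smul a X _ hX =>
    obtain ⟨P, hP⟩ := hX
    refine ⟨Polynomial.C (a : ℂ) * P, fun t => ?_⟩
    rw [show lp (Polynomial.C (a : ℂ) * P) = C (a : ℂ) * lp P by simp [lp]; ring, map_mul, ← hP]
    simp [lev_apply]

lemma isTrigPoly_lev_lp (P : Polynomial ℂ) : IsTrigPoly fun t => (lev (cis t) (lp P)).re := by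
  induction P using Polynomial.induction_on' with
  | add P Q hP hQ =>
    have := Submodule.add_mem _ hP hQ
    refine (congrArg IsTrigPoly (funext fun t => ?_)).mpr this
    simp [lp]
    ring
  | monomial k c =>
    have hc := Submodule.smul_mem (Submodule.span ℝ
      (Set.range (fun (k : ℕ) (t : ℝ) => Real.sin (k * t)) ∪
        Set.range (fun (k : ℕ) (t : ℝ) => Real.cos (k * t)))) (2 * c.re)
      (Submodule.subset_span (Or.inr ⟨k, rfl⟩))
    have hs := Submodule.smul_mem (Submodule.span ℝ
      (Set.range (fun (k : ℕ) (t : ℝ) => Real.sin (k * t)) ∪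
        Set.range (fun (k : ℕ) (t : ℝ) => Real.cos (k * t)))) (-2 * c.im)
      (Submodule.subset_span (Or.inl ⟨k, rfl⟩))
    have := Submodule.add_mem _ hc hs
    refine (congrArg IsTrigPoly (funext fun t => ?_)).mpr this
    simp only [lev_lp, Polynomial.map_monomial, Polynomial.aeval_monomial, Algebra.algebraMap_self,
      RingHom.id_apply, Units.val_inv_eq_inv_val, cis_val, ← Complex.exp_neg, ← Complex.exp_nat_mul]
    rw [show (k : ℂ) * (t * Complex.I) = ((k * t : ℝ) : ℂ) * Complex.I by push_cast; ring,
      show (k : ℂ) * (-(t * Complex.I)) = ((-(k * t) : ℝ) : ℂ) * Complex.I by push_cast; ring]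
    simp only [Complex.add_re, Complex.mul_re, Complex.exp_ofReal_mul_I_re,
      Complex.exp_ofReal_mul_I_im, Complex.conj_re, Complex.conj_im, Pi.add_apply, Pi.smul_apply,
      smul_eq_mul, Real.cos_neg, Real.sin_neg]
    ring

end

section

/-! ### Rational function fields and their places -/

section Places

open Polynomial IntermediateField

variable {k F : Type*} [Field k] [Field F] [Algebra k F]

/-- `r` generates `F` over `k` as a field of rational functions, that is, `r` is a coordinate on the
projective line with function field `F`. -/
structure IsGen (k : Type*) {F : Type*} [Field k] [Field F] [Algebra k F] (r : F) : Prop where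
  transcendental : Transcendental k r
  adjoin_eq_top : k⟮r⟯ = ⊤

/-- A place of `F` over `k`: a valuation ring containing the constants. The trivial valuation ring
`F` is allowed. -/
def IsPlace (k : Type*) {F : Type*} [Field k] [Field F] [Algebra k F]
    (V : ValuationSubring F) : Prop :=
  ∀ c : k, algebraMap k F c ∈ V

/-- Transcendence of `r'` is automatic, as otherwise `F` would be algebraic over `k`. -/
lemma IsGen.of_mem {r r' : F} (h : IsGen k r) (hr : r ∈ k⟮r'⟯) : IsGen k r' := by
  have htop : k⟮r'⟯ = ⊤ := by
    rw [eq_top_iff, ← h.adjoin_eq_top]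
    exact adjoin_simple_le_iff.2 hr
  refine ⟨fun halg => h.transcendental ?_, htop⟩
  have := isAlgebraic_adjoin_simple halg.isIntegral
  have h' := this.isAlgebraic ⟨r, hr⟩
  exact (isAlgebraic_algebraMap_iff (algebraMap k⟮r'⟯ F).injective).2 h'

lemma IsGen.inv {r : F} (h : IsGen k r) : IsGen k r⁻¹ :=
  h.of_mem (by simpa using inv_mem (mem_adjoin_simple_self k r⁻¹))

lemma IsGen.affine {r : F} (h : IsGen k r) {a : k} (ha : a ≠ 0) (b : k) :
    IsGen k (algebraMap k F a * r + algebraMap k F b) := by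
  refine h.of_mem ?_
  set s := algebraMap k F a * r + algebraMap k F b with hs
  have ha' : algebraMap k F a ≠ 0 := by simpa using ha
  have : r = algebraMap k F a⁻¹ * (s - algebraMap k F b) := by
    rw [hs, map_inv₀]; field_simp; ring
  rw [this]
  exact mul_mem (_root_.algebraMap_mem _ _)
    (sub_mem (mem_adjoin_simple_self k s) (_root_.algebraMap_mem _ _))

lemma IsGen.sub_const {r : F} (h : IsGen k r) (b : k) : IsGen k (r - algebraMap k F b) := by
  simpa [sub_eq_add_neg] using h.affine one_ne_zero (-b)

lemma IsGen.aeval_ne_zero {r : F} (h : IsGen k r) {p : k[X]} (hp : p ≠ 0) : aeval r p ≠ 0 :=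
  fun h0 => hp (transcendental_iff.1 h.transcendental p h0)

lemma IsGen.ne_zero {r : F} (h : IsGen k r) : r ≠ 0 := by
  simpa using h.aeval_ne_zero X_ne_zero

lemma IsGen.exists_div {r : F} (h : IsGen k r) (x : F) :
    ∃ p q : k[X], IsCoprime p q ∧ q ≠ 0 ∧ x = aeval r p / aeval r q := by
  classical
  have hx : x ∈ k⟮r⟯ := h.adjoin_eq_top ▸ mem_top
  obtain ⟨p, q, hpq⟩ := (mem_adjoin_simple_iff k x).1 hx
  by_cases hq : q = 0
  · exact ⟨0, 1, isCoprime_one_right, one_ne_zero, by simp [hpq, hq]⟩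
  have hg : EuclideanDomain.gcd p q ≠ 0 := fun h0 => hq (EuclideanDomain.gcd_eq_zero_iff.1 h0).2
  obtain ⟨p', hp'⟩ := EuclideanDomain.gcd_dvd_left p q
  obtain ⟨q', hq'⟩ := EuclideanDomain.gcd_dvd_right p q
  have hq0 : q' ≠ 0 := by
    rintro rfl
    exact hq (by rw [hq', mul_zero])
  refine ⟨p', q', ?_, hq0, ?_⟩
  · obtain ⟨a, b, hab⟩ : ∃ a b, a * p + b * q = EuclideanDomain.gcd p q :=
      ⟨EuclideanDomain.gcdA p q, EuclideanDomain.gcdB p q, by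
        rw [mul_comm _ p, mul_comm _ q]; exact (EuclideanDomain.gcd_eq_gcd_ab p q).symm⟩
    refine ⟨a, b, mul_left_cancel₀ hg ?_⟩
    linear_combination hab - a * hp' - b * hq'
  · rw [hpq, ← mul_div_mul_left (aeval r p') _ (h.aeval_ne_zero hg), ← map_mul, ← map_mul, ← hp',
      ← hq']

lemma IsGen.nonempty_algEquiv {r : F} (h : IsGen k r) : Nonempty (RatFunc k ≃ₐ[k] F) :=
  ⟨(RatFunc.algEquivOfTranscendental r h.transcendental).trans
    ((equivOfEq h.adjoin_eq_top).trans topEquiv)⟩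

lemma isGen_of_algEquiv (e : RatFunc k ≃ₐ[k] F) : IsGen k (e RatFunc.X) := by
  refine ⟨?_, ?_⟩
  · have : Transcendental k (RatFunc.X : RatFunc k) := RatFunc.transcendental_X
    exact fun h => this ((isAlgebraic_algHom_iff e.toAlgHom e.injective).1 h)
  · have := congrArg (IntermediateField.map e.toAlgHom) (RatFunc.adjoin_X (K := k))
    rw [adjoin_map, Set.image_singleton] at this
    rw [show e RatFunc.X = e.toAlgHom RatFunc.X from rfl, this, eq_top_iff]
    exact fun x _ => ⟨e.symm x, mem_top, e.apply_symm_apply x⟩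

/-- Lüroth's theorem for subfields of `k(r)`. -/
lemma IsGen.exists_isGen_of_algHom {K : Type*} [Field K] [Algebra k K] {r : K} (h : IsGen k r)
    (i : F →ₐ[k] K) {x : F} (hx : Transcendental k x) : ∃ s : F, IsGen k s := by
  obtain ⟨e⟩ := h.nonempty_algEquiv
  let j : F →ₐ[k] RatFunc k := e.symm.toAlgHom.comp i
  have hne : j.fieldRange ≠ ⊥ := by
    intro hbot
    have : j x ∈ (⊥ : IntermediateField k (RatFunc k)) := hbot ▸ ⟨x, rfl⟩
    obtain ⟨c, hc⟩ := mem_bot.1 this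
    refine hx ((isAlgebraic_algHom_iff j j.injective).1 ?_)
    rw [← hc]
    exact isAlgebraic_algebraMap c
  let e' := (RatFunc.Luroth.algEquiv hne).trans (AlgEquiv.ofInjectiveField j).symm
  exact ⟨_, isGen_of_algEquiv e'⟩

section Valuation

variable {V W : ValuationSubring F}

lemma IsPlace.valuation_const (hV : IsPlace k V) {c : k} (hc : c ≠ 0) :
    V.valuation (algebraMap k F c) = 1 := by
  refine le_antisymm ((V.valuation_le_one_iff _).2 (hV c)) ?_
  have h := (V.valuation_le_one_iff _).2 (hV c⁻¹)
  have hc' : algebraMap k F c ≠ 0 := by simpa using hc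
  rw [map_inv₀, map_inv₀] at h
  exact (inv_le_one₀ (zero_lt_iff.2 ((_root_.map_ne_zero _).2 hc'))).1 h

lemma IsPlace.aeval_mem (hV : IsPlace k V) {r : F} (hr : r ∈ V) (p : k[X]) : aeval r p ∈ V := by
  induction p using Polynomial.induction_on' with
  | add p q hp hq => rw [map_add]; exact V.add_mem _ _ hp hq
  | monomial n a =>
    rw [aeval_monomial]
    exact V.mul_mem _ _ (hV a) (pow_mem hr n)

lemma mem_of_valuation_lt_one {r : F} (hr : V.valuation r < 1) : r ∈ V :=
  (V.valuation_le_one_iff _).1 hr.le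

lemma IsPlace.valuation_aeval (hV : IsPlace k V) {r : F} (hr : V.valuation r < 1) {p : k[X]}
    (hp : p.coeff 0 ≠ 0) : V.valuation (aeval r p) = 1 := by
  rw [← X_mul_divX_add p, map_add, map_mul, aeval_X, aeval_C, Valuation.map_add_eq_of_lt_right,
    hV.valuation_const hp]
  rw [hV.valuation_const hp, map_mul]
  exact mul_lt_one_of_lt_of_le hr
    ((V.valuation_le_one_iff _).2 (hV.aeval_mem (mem_of_valuation_lt_one hr) _))

lemma IsPlace.le_of_valuation_lt_one (hV : IsPlace k V) (hW : IsPlace k W) {r : F}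
    (hr : IsGen k r) (hVr : V.valuation r < 1) (hWr : W.valuation r < 1) : V ≤ W := by
  intro x hx
  obtain ⟨p, q, hpq, hq, rfl⟩ := hr.exists_div x
  by_cases hq0 : q.coeff 0 = 0
  · exfalso
    -- a fraction in lowest terms whose denominator vanishes at `r = 0` has a pole there
    have hp0 : p.coeff 0 ≠ 0 := by
      intro hp0
      obtain ⟨a, b, hab⟩ := hpq
      have := congrArg (fun f => f.coeff 0) hab
      simp [hp0, hq0] at this
    have hqv : V.valuation (aeval r q) < 1 := by
      rw [← X_mul_divX_add q, hq0, C_0, add_zero, map_mul, aeval_X, map_mul]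
      exact mul_lt_one_of_lt_of_le hVr
        ((V.valuation_le_one_iff _).2 (hV.aeval_mem (mem_of_valuation_lt_one hVr) _))
    have h1 := (V.valuation_le_one_iff _).2 hx
    rw [map_div₀, hV.valuation_aeval hVr hp0, one_div] at h1
    exact absurd hqv (not_lt.2 ((inv_le_one₀ (zero_lt_iff.2 ((_root_.map_ne_zero _).2
      (hr.aeval_ne_zero hq)))).1 h1))
  · rw [← W.valuation_le_one_iff, map_div₀, hW.valuation_aeval hWr hq0, div_one,
      W.valuation_le_one_iff]
    exact hW.aeval_mem (mem_of_valuation_lt_one hWr) _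

/-- The point `r = 0` of the projective line carries only one place. -/
lemma IsPlace.eq_of_valuation_lt_one (hV : IsPlace k V) (hW : IsPlace k W) {r : F}
    (hr : IsGen k r) (hVr : V.valuation r < 1) (hWr : W.valuation r < 1) : V = W :=
  le_antisymm (hV.le_of_valuation_lt_one hW hr hVr hWr) (hW.le_of_valuation_lt_one hV hr hWr hVr)

lemma valuation_inv_lt_one {r : F} (hr : r ∉ V) : V.valuation r⁻¹ < 1 := by
  have h : 1 < V.valuation r := not_le.1 fun h => hr ((V.valuation_le_one_iff _).1 h)
  rw [map_inv₀]
  exact inv_lt_one_of_one_lt₀ h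

lemma notMem_of_valuation_inv_lt_one {r : F} (h0 : r ≠ 0) (hr : V.valuation r⁻¹ < 1) : r ∉ V := by
  intro h
  have h1 := (V.valuation_le_one_iff _).2 h
  rw [map_inv₀] at hr
  have hpos : 0 < V.valuation r := zero_lt_iff.2 ((_root_.map_ne_zero _).2 h0)
  exact absurd hr (not_lt.2 ((one_le_inv₀ hpos).2 h1))

/-- As `k` is algebraically closed, a place at which `r` is regular has a residue `c` of `r` in `k`:
otherwise all polynomials in `r` would be units there. -/
lemma IsPlace.exists_residue [IsAlgClosed k] (hV : IsPlace k V) (hV' : V ≠ ⊤) {r : F}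
    (hr : IsGen k r) (hrV : r ∈ V) : ∃ c : k, V.valuation (r - algebraMap k F c) < 1 := by
  by_contra! hcon
  have h1 : ∀ p : k[X], p ≠ 0 → V.valuation (aeval r p) = 1 := by
    intro p hp
    have hs := (IsAlgClosed.splits p).eq_prod_roots
    rw [hs, map_mul, map_mul, aeval_C, hV.valuation_const (leadingCoeff_ne_zero.2 hp), one_mul,
      map_multiset_prod, map_multiset_prod]
    refine Multiset.prod_eq_one fun x hx => ?_
    simp only [Multiset.map_map, Multiset.mem_map, Function.comp_apply] at hx
    obtain ⟨c, -, rfl⟩ := hx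
    rw [map_sub, aeval_X, aeval_C]
    exact le_antisymm ((V.valuation_le_one_iff _).2 (sub_mem hrV (hV c))) (hcon c)
  refine hV' (eq_top_iff.2 fun x _ => ?_)
  obtain ⟨p, q, -, hq, rfl⟩ := hr.exists_div x
  rw [← V.valuation_le_one_iff, map_div₀, h1 q hq, div_one, V.valuation_le_one_iff]
  exact hV.aeval_mem hrV p

/-- Every nontrivial place of `k(r)` is the zero of a suitable generator. -/
lemma IsPlace.exists_isGen [IsAlgClosed k] (hV : IsPlace k V) (hV' : V ≠ ⊤) {r : F}
    (hr : IsGen k r) : ∃ s : F, IsGen k s ∧ V.valuation s < 1 := by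
  by_cases hrV : r ∈ V
  · obtain ⟨c, hc⟩ := hV.exists_residue hV' hr hrV
    exact ⟨_, hr.sub_const c, hc⟩
  · exact ⟨_, hr.inv, valuation_inv_lt_one hrV⟩

/-- The integral closure of a subring is the intersection of the valuation rings above it. -/
lemma isIntegral_of_forall_mem {R : Type*} [CommRing R] [Algebra R F] {x : F}
    (hx : ∀ W : ValuationSubring F, (∀ a : R, algebraMap R F a ∈ W) → x ∈ W) :
    IsIntegral R x := by
  have h1 : x ∈ ⨅ V : {V : ValuationSubring F // Set.range (algebraMap R F) ⊆ V.toSubring},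
      V.1.toSubring := by
    rw [Subring.mem_iInf]
    exact fun V => hx V.1 fun a => V.2 ⟨a, rfl⟩
  rw [iInf_valuationSubring_superset] at h1
  have h2 : IsIntegral (Subring.closure (Set.range (algebraMap R F))) x := h1
  have hcl : Subring.closure (Set.range (algebraMap R F)) = (algebraMap R F).range :=
    Subring.closure_eq (algebraMap R F).range
  rw [hcl] at h2
  obtain ⟨p, hp, hp0⟩ := h2
  obtain ⟨q, hq, -, hqm⟩ := lifts_and_natDegree_eq_and_monic (f := (algebraMap R F).rangeRestrict)
    (p := p) ((mem_lifts p).2 (map_surjective _ (algebraMap R F).rangeRestrict_surjective p)) hp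
  refine ⟨q, hqm, ?_⟩
  rw [← hq, eval₂_map] at hp0
  exact hp0

/-- A function which is regular at all places where the elements of an integrally closed ring are
regular belongs to that ring. -/
lemma exists_algebraMap_eq_of_forall_mem {R : Type*} [CommRing R] [IsDomain R]
    [IsIntegrallyClosed R] [Algebra R F] [IsFractionRing R F] {x : F}
    (hx : ∀ W : ValuationSubring F, (∀ a : R, algebraMap R F a ∈ W) → x ∈ W) :
    ∃ a : R, algebraMap R F a = x :=
  IsIntegrallyClosed.isIntegral_iff.1 (isIntegral_of_forall_mem hx)

lemma IsGen.exists_aeval_eq {r : F} (hr : IsGen k r) {x : F}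
    (hx : ∀ W : ValuationSubring F, IsPlace k W → r ∈ W → x ∈ W) : ∃ p : k[X], aeval r p = x := by
  let _ : Algebra k[X] F := (aeval r).toRingHom.toAlgebra
  have hmap : ∀ p, algebraMap k[X] F p = aeval r p := fun p => rfl
  have hinj : Function.Injective (algebraMap k[X] F) :=
    transcendental_iff_injective.1 hr.transcendental
  have : FaithfulSMul k[X] F := (faithfulSMul_iff_algebraMap_injective _ _).2 hinj
  have : IsFractionRing k[X] F := IsFractionRing.of_field _ _ fun z => by
    obtain ⟨p, q, -, -, h⟩ := hr.exists_div z
    exact ⟨p, q, h⟩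
  refine exists_algebraMap_eq_of_forall_mem (R := k[X]) fun W hW => hx W (fun c => ?_) ?_
  · simpa [hmap] using hW (C c)
  · simpa [hmap] using hW X

/-- A transcendental element has a zero at some place. -/
lemma exists_place_valuation_lt_one [IsAlgClosed k] {t : F} (ht : Transcendental k t) :
    ∃ W : ValuationSubring F, IsPlace k W ∧ W.valuation t < 1 := by
  by_contra! hcon
  have h3 : IsIntegral k t⁻¹ := isIntegral_of_forall_mem fun W hW => by
    by_contra hW'
    exact absurd (by simpa using valuation_inv_lt_one hW') (not_lt.2 (hcon W hW))
  refine ht ?_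
  simpa using h3.isAlgebraic.inv

/-- Two generators with the same pole are polynomials in each other, hence differ by an affine
substitution. -/
lemma IsGen.exists_affine {r s : F} (hr : IsGen k r) (hs : IsGen k s)
    (h : ∀ W : ValuationSubring F, IsPlace k W → (r ∈ W ↔ s ∈ W)) :
    ∃ a b : k, a ≠ 0 ∧ s = algebraMap k F a * r + algebraMap k F b := by
  obtain ⟨p, hp⟩ := hr.exists_aeval_eq fun W hW => (h W hW).1
  obtain ⟨q, hq⟩ := hs.exists_aeval_eq fun W hW => (h W hW).2
  have hcomp : q.comp p = X := by
    have : aeval r (q.comp p - X) = 0 := by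
      rw [map_sub, aeval_comp, hp, hq, aeval_X, sub_self]
    exact sub_eq_zero.1 (transcendental_iff.1 hr.transcendental _ this)
  have hdeg : p.natDegree = 1 := by
    have := congrArg natDegree hcomp
    rw [natDegree_comp, natDegree_X] at this
    exact Nat.eq_one_of_mul_eq_one_left this
  refine ⟨p.coeff 1, p.coeff 0, ?_, ?_⟩
  · rw [← hdeg]
    exact leadingCoeff_ne_zero.2 (by rintro rfl; simp at hdeg)
  · rw [← hp]
    conv_lhs => rw [eq_X_add_C_of_natDegree_le_one hdeg.le]
    simp

/-- Two points of the projective line can be moved to `0` and `∞`. -/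
lemma IsPlace.exists_isGen_zero_pole [IsAlgClosed k] (hV : IsPlace k V) (hW : IsPlace k W)
    (hV' : V ≠ ⊤) (hW' : W ≠ ⊤) (hne : V ≠ W) {r₀ : F} (hr₀ : IsGen k r₀) :
    ∃ r : F, IsGen k r ∧ V.valuation r < 1 ∧ W.valuation r⁻¹ < 1 := by
  obtain ⟨r, hr, hVr⟩ := hV.exists_isGen hV' hr₀
  by_cases hrW : r ∈ W
  · obtain ⟨c, hc⟩ := hW.exists_residue hW' hr hrW
    have hc0 : c ≠ 0 := by
      rintro rfl
      exact hne (hV.eq_of_valuation_lt_one hW hr hVr (by simpa using hc))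
    have h1 : V.valuation (r - algebraMap k F c) = 1 := by
      have := hV.valuation_aeval hVr (p := X - C c) (by simpa using hc0)
      rwa [map_sub, aeval_X, aeval_C] at this
    have h2 : W.valuation r = 1 := by
      have := hW.valuation_aeval hc (p := X + C c) (by simpa using hc0)
      rwa [map_add, aeval_X, aeval_C, sub_add_cancel] at this
    have hs := hr.sub_const c
    have heq : algebraMap k F c * (r - algebraMap k F c)⁻¹ + algebraMap k F 1 =
        r * (r - algebraMap k F c)⁻¹ := by
      have := hs.ne_zero
      field_simp
      simp
    refine ⟨r * (r - algebraMap k F c)⁻¹, heq ▸ hs.inv.affine hc0 1, ?_, ?_⟩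
    · rw [map_mul, map_inv₀, h1]; simpa using hVr
    · rw [mul_inv, inv_inv, map_mul, map_inv₀, h2]; simpa using hc
  · exact ⟨r, hr, hVr, valuation_inv_lt_one hrW⟩

/-- A nonconstant polynomial in `u` has a pole wherever `u` has one. -/
lemma IsPlace.aeval_notMem (hV : IsPlace k V) {u : F} (hu : u ∉ V) {p : k[X]}
    (hp : p.natDegree ≠ 0) : aeval u p ∉ V := by
  have hu1 : 1 < V.valuation u := not_le.1 fun h => hu ((V.valuation_le_one_iff _).1 h)
  rw [← V.valuation_le_one_iff, not_le]
  induction hn : p.natDegree using Nat.strong_induction_on generalizing p with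
  | _ n ih =>
    have hd : p.divX.natDegree = n - 1 := by rw [natDegree_divX_eq_natDegree_tsub_one, hn]
    have h1 : 1 < V.valuation (u * aeval u p.divX) := by
      rw [map_mul]
      by_cases h0 : p.divX.natDegree = 0
      · have hc : p.divX.coeff 0 ≠ 0 := by
          rw [coeff_divX, zero_add, show 1 = p.natDegree by omega]
          exact leadingCoeff_ne_zero.2 (by rintro rfl; simp at hp)
        rw [eq_C_of_natDegree_eq_zero h0, aeval_C, hV.valuation_const hc, mul_one]
        exact hu1
      · exact one_lt_mul_of_lt_of_le' hu1 (ih _ (by omega) h0 rfl).le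
    rw [← X_mul_divX_add p, map_add, map_mul, aeval_X, aeval_C, Valuation.map_add_eq_of_lt_left]
    · exact h1
    · exact lt_of_le_of_lt ((V.valuation_le_one_iff _).2 (hV _)) h1

end Valuation

section Laurent

variable {F : Type*} [Field F] [Algebra ℂ F] {r : Fˣ}

/-- The action of Laurent polynomials on `F` is the one given by substituting `r`. -/
lemma IsGen.isFractionRing_laurent (hr : IsGen ℂ (r : F)) :
    letI : Algebra (LaurentPolynomial ℂ) F := (lev r).toRingHom.toAlgebra
    IsFractionRing (LaurentPolynomial ℂ) F := by
  let _ : Algebra (LaurentPolynomial ℂ) F := (lev r).toRingHom.toAlgebra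
  have hmap : ∀ f, algebraMap (LaurentPolynomial ℂ) F f = lev r f := fun f => rfl
  have : FaithfulSMul (LaurentPolynomial ℂ) F :=
    (faithfulSMul_iff_algebraMap_injective _ _).2 (lev_injective hr.transcendental)
  exact IsFractionRing.of_field _ _ fun z => by
    obtain ⟨p, q, -, -, h⟩ := hr.exists_div z
    exact ⟨toLaurent p, toLaurent q, by rw [hmap, hmap, lev_toLaurent, lev_toLaurent, h]⟩

/-- A function on the projective line with coordinate `r` that is regular away from the points
`0` and `∞` is a Laurent polynomial in `r`. -/
lemma IsGen.exists_lev_eq (hr : IsGen ℂ (r : F)) {x : F}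
    (hx : ∀ W : ValuationSubring F, IsPlace ℂ W → (r : F) ∈ W → (r : F)⁻¹ ∈ W → x ∈ W) :
    ∃ f, lev r f = x := by
  let _ : Algebra (LaurentPolynomial ℂ) F := (lev r).toRingHom.toAlgebra
  have hmap : ∀ f, algebraMap (LaurentPolynomial ℂ) F f = lev r f := fun f => rfl
  have : IsFractionRing (LaurentPolynomial ℂ) F := hr.isFractionRing_laurent
  have : IsIntegrallyClosed (LaurentPolynomial ℂ) :=
    isIntegrallyClosed_of_isLocalization _ (Submonoid.powers (X : ℂ[X]))
      (powers_le_nonZeroDivisors_of_noZeroDivisors X_ne_zero)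
  refine exists_algebraMap_eq_of_forall_mem (R := LaurentPolynomial ℂ) fun W hW =>
    hx W (fun c => ?_) ?_ ?_
  · exact (lev r).commutes c ▸ hW (algebraMap ℂ _ c)
  · simpa [hmap] using hW (LaurentPolynomial.T 1)
  · simpa [hmap] using hW (LaurentPolynomial.T (-1))

/-- The conjugation `r ↦ r⁻¹` of `ℂ(r)`. -/
lemma IsGen.exists_conj (hr : IsGen ℂ (r : F)) :
    ∃ τ : F ≃+* F, ∀ f, τ (lev r f) = lev r (lconj f) := by
  let _ : Algebra (LaurentPolynomial ℂ) F := (lev r).toRingHom.toAlgebra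
  have : IsFractionRing (LaurentPolynomial ℂ) F := hr.isFractionRing_laurent
  exact ⟨IsFractionRing.ringEquivOfRingEquiv lconj,
    fun f => IsFractionRing.ringEquivOfRingEquiv_algebraMap (K := F) (L := F) lconj f⟩

end Laurent

end Places

end

section

/-! ### Real and complex points -/

open scoped ComplexConjugate

lemma mem_points {K : Type} [Field K] [Algebra ℝ K] {G : MvPolynomial (Fin 2) ℝ} {p : K × K} :
    p ∈ points K G ↔ MvPolynomial.aeval ![p.1, p.2] G = 0 := Iff.rfl

lemma ofReal_mem_points {G : MvPolynomial (Fin 2) ℝ} {p : ℝ × ℝ} :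
    ((p.1 : ℂ), (p.2 : ℂ)) ∈ points ℂ G ↔ p ∈ points ℝ G := by
  have h := MvPolynomial.aeval_algebraMap_apply ℂ ![p.1, p.2] G
  have hv : (algebraMap ℝ ℂ ∘ ![p.1, p.2]) = ![(p.1 : ℂ), (p.2 : ℂ)] := by
    ext i; fin_cases i <;> simp
  rw [hv] at h
  simp only [points, Set.mem_ofPred_eq]
  rw [h]
  simp

lemma aeval_complexify (G : MvPolynomial (Fin 2) ℝ) {A : Type*} [CommRing A] [Algebra ℂ A]
    [Algebra ℝ A] [IsScalarTower ℝ ℂ A] (v : Fin 2 → A) :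
    MvPolynomial.aeval v (complexify G) = MvPolynomial.aeval v G :=
  MvPolynomial.aeval_map_algebraMap ℂ v G

lemma conj_aeval (v : Fin 2 → ℂ) (H : MvPolynomial (Fin 2) ℂ) :
    conj (MvPolynomial.aeval v H) =
      MvPolynomial.aeval (fun i => conj (v i)) (MvPolynomial.map (starRingEnd ℂ) H) := by
  induction H using MvPolynomial.induction_on with
  | C a => simp
  | add p q hp hq => rw [map_add, map_add, map_add, map_add, hp, hq]
  | mul_X p i hp => rw [map_mul, map_mul, map_mul, map_mul, hp, MvPolynomial.map_X,
      MvPolynomial.aeval_X, MvPolynomial.aeval_X]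

/-- The point with coordinates `P(z) + P̄(z⁻¹)` and `Q(z) + Q̄(z⁻¹)`. -/
def lpt (P Q : Polynomial ℂ) (z : ℂˣ) : ℂ × ℂ := (lev z (lp P), lev z (lp Q))

lemma lpt_circleInv (P Q : Polynomial ℂ) (z : ℂˣ) :
    lpt P Q (circleInv z) = (conj (lpt P Q z).1, conj (lpt P Q z).2) := by
  have h : ∀ P, lev (circleInv z) (lp P) = conj (lev z (lp P)) := by
    intro P
    rw [← Complex.conj_conj (lev (circleInv z) (lp P)), ← lev_lconj, lconj_lp]
  simp [lpt, h]

lemma circleInv_injective : Function.Injective circleInv := by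
  intro z w h
  have := congrArg Units.val h
  rw [circleInv_val, circleInv_val, inv_inj] at this
  exact Units.ext ((starRingEnd ℂ).injective this)

lemma isGenericParam_lpt_iff {P Q : Polynomial ℂ} {C : Set (ℂ × ℂ)} :
    IsGenericParam (fun φ : ℂ => (laurentEval P φ, laurentEval Q φ)) {φ : ℂ | φ ≠ 0} C ↔
      IsGenericParam (lpt P Q) Set.univ C := by
  have hval : ∀ z : ℂˣ, (laurentEval P z, laurentEval Q z) = lpt P Q z := fun z => by
    simp [lpt, lev_lp_eq_laurentEval]
  have himg : (fun φ : ℂ => (laurentEval P φ, laurentEval Q φ)) '' {φ : ℂ | φ ≠ 0} =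
      lpt P Q '' Set.univ := by
    ext p
    constructor
    · rintro ⟨φ, hφ, rfl⟩
      exact ⟨Units.mk0 φ hφ, trivial, (hval _).symm⟩
    · rintro ⟨z, -, rfl⟩
      exact ⟨z, z.ne_zero, hval z⟩
  constructor
  · rintro ⟨h1, h2, E, hE, hinj⟩
    refine ⟨Set.mapsTo_iff_image_subset.2 (himg ▸ h1.image_subset), himg ▸ h2,
      Units.val ⁻¹' E, hE.preimage Units.val_injective.injOn, ?_⟩
    intro z hz w hw h
    refine Units.ext (hinj ⟨z.ne_zero, hz.2⟩ ⟨w.ne_zero, hw.2⟩ ?_)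
    simpa only [hval] using h
  · rintro ⟨h1, h2, E, hE, hinj⟩
    refine ⟨Set.mapsTo_iff_image_subset.2 (himg ▸ h1.image_subset), himg ▸ h2,
      Units.val '' E, hE.image _, ?_⟩
    intro z hz w hw h
    lift z to ℂˣ using (Ne.isUnit hz.1)
    lift w to ℂˣ using (Ne.isUnit hw.1)
    refine congrArg Units.val (hinj ⟨trivial, fun h => hz.2 ⟨_, h, rfl⟩⟩
      ⟨trivial, fun h => hw.2 ⟨_, h, rfl⟩⟩ ?_)
    rw [← hval, ← hval]
    exact h

/-- Restricting a generically injective Laurent parametrization to the unit circle parametrizes the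
real points: a real point which comes from `z` also comes from `z̄⁻¹`. -/
lemma isTrigonometric_of_lpt {G : MvPolynomial (Fin 2) ℝ} {P Q : Polynomial ℂ}
    (h : IsGenericParam (lpt P Q) Set.univ (points ℂ G)) : IsTrigonometric G := by
  obtain ⟨h1, h2, E, hE, hinj⟩ := h
  let X : ℝ → ℝ := fun t => (lev (cis t) (lp P)).re
  let Y : ℝ → ℝ := fun t => (lev (cis t) (lp Q)).re
  let ι : ℝ × ℝ → ℂ × ℂ := fun p => ((p.1 : ℂ), (p.2 : ℂ))
  have hι : Function.Injective ι := by
    rintro ⟨a, b⟩ ⟨c, d⟩ h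
    simpa [ι] using h
  have hXY : ∀ t, ι (X t, Y t) = lpt P Q (cis t) := fun t =>
    Prod.ext (lev_cis_real (lconj_lp P) t) (lev_cis_real (lconj_lp Q) t)
  refine ⟨X, Y, isTrigPoly_lev_lp P, isTrigPoly_lev_lp Q, ?_, ?_,
    {t ∈ Set.Ico 0 (2 * Real.pi) | cis t ∈ E}, ?_, ?_⟩
  · intro t _
    rw [← ofReal_mem_points]
    have := h1 (Set.mem_univ (cis t))
    rwa [← hXY] at this
  · have hfin : (points ℂ G \ lpt P Q '' Set.univ ∪ lpt P Q '' (E ∪ circleInv ⁻¹' E)).Finite :=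
      h2.union ((hE.union (hE.preimage circleInv_injective.injOn)).image _)
    refine (hfin.preimage hι.injOn).subset ?_
    rintro p ⟨hp, hp'⟩
    by_contra hcon
    simp only [Set.mem_preimage, Set.mem_union, not_or] at hcon
    obtain ⟨hc1, hc2⟩ := hcon
    obtain ⟨z, -, hz⟩ : ι p ∈ lpt P Q '' Set.univ := by
      by_contra h
      exact hc1 ⟨ofReal_mem_points.2 hp, h⟩
    have hzE : z ∉ E := fun h => hc2 ⟨z, Or.inl h, hz⟩
    have hzE' : circleInv z ∉ E := fun h => hc2 ⟨z, Or.inr h, hz⟩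
    have hzz : circleInv z = z := by
      refine hinj ⟨trivial, hzE'⟩ ⟨trivial, hzE⟩ ?_
      rw [lpt_circleInv, hz]
      simp [ι]
    obtain ⟨t, ht, rfl⟩ := exists_cis hzz
    exact hp' ⟨t, ht, hι (by rw [hXY, hz])⟩
  · refine Set.Finite.of_finite_image (f := cis) (hE.subset ?_) (cis_injOn.mono fun t ht => ht.1)
    rintro _ ⟨t, ht, rfl⟩
    exact ht.2
  · intro s hs t ht hst
    have h' : lpt P Q (cis s) = lpt P Q (cis t) := by
      rw [← hXY, ← hXY]; exact congrArg ι hst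
    exact cis_injOn hs.1 ht.1 (hinj ⟨trivial, fun h => hs.2 ⟨hs.1, h⟩⟩
      ⟨trivial, fun h => ht.2 ⟨ht.1, h⟩⟩ h')

end

section

/-! ### The function field of the curve and its conjugation -/

open scoped ComplexConjugate
open LaurentPolynomial

section FunctionField

variable (G : MvPolynomial (Fin 2) ℝ)

/-- A polynomial as a function on the curve. -/
def toF : MvPolynomial (Fin 2) ℂ →ₐ[ℂ] FunctionField G :=
  (IsScalarTower.toAlgHom ℂ (CoordRing G) (FunctionField G)).comp (Ideal.Quotient.mkₐ ℂ _)

lemma toF_apply (H : MvPolynomial (Fin 2) ℂ) :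
    toF G H = algebraMap (CoordRing G) (FunctionField G) (Ideal.Quotient.mk _ H) := rfl

lemma toF_X (i : Fin 2) : toF G (MvPolynomial.X i) = coord G i := rfl

lemma toF_eq_aeval : toF G = MvPolynomial.aeval (coord G) := by
  ext i; rw [toF_X, MvPolynomial.aeval_X]

variable {G}

lemma toF_eq_zero {H : MvPolynomial (Fin 2) ℂ} : toF G H = 0 ↔ complexify G ∣ H := by
  rw [toF_apply, IsFractionRing.to_map_eq_zero_iff, Ideal.Quotient.eq_zero_iff_mem,
    Ideal.mem_span_singleton]

lemma aeval_eq_zero_of_toF {H : MvPolynomial (Fin 2) ℂ} (h : toF G H = 0) {p : ℂ × ℂ}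
    (hp : p ∈ points ℂ G) : MvPolynomial.aeval ![p.1, p.2] H = 0 := by
  obtain ⟨H', rfl⟩ := toF_eq_zero.1 h
  rw [map_mul, aeval_complexify, mem_points.1 hp, zero_mul]

lemma conjFunctionField_toF (H : MvPolynomial (Fin 2) ℂ) :
    conjFunctionField G (toF G H) = toF G (MvPolynomial.map (starRingEnd ℂ) H) := by
  rw [toF_apply, conjFunctionField, IsFractionRing.ringEquivOfRingEquiv_algebraMap]
  rfl

lemma conjFunctionField_algebraMap (c : ℂ) :
    conjFunctionField G (algebraMap ℂ _ c) = algebraMap ℂ _ (conj c) := by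
  have := conjFunctionField_toF (G := G) (MvPolynomial.C c)
  rw [MvPolynomial.map_C] at this
  simpa [← MvPolynomial.algebraMap_eq] using this

lemma conjFunctionField_coord (i : Fin 2) : conjFunctionField G (coord G i) = coord G i := by
  rw [← toF_X, conjFunctionField_toF, MvPolynomial.map_X]

lemma conjFunctionField_aeval (r : FunctionField G) (p : Polynomial ℂ) :
    conjFunctionField G (Polynomial.aeval r p) =
      Polynomial.aeval (conjFunctionField G r) (p.map (starRingEnd ℂ)) := by
  induction p using Polynomial.induction_on' with
  | add p q hp hq => simp [hp, hq]
  | monomial n a => simp [Polynomial.aeval_monomial, conjFunctionField_algebraMap]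

/-- The function `x` on the curve is regular at the point `p` and takes the value `v` there. -/
def HasValue (p : ℂ × ℂ) (x : FunctionField G) (v : ℂ) : Prop :=
  ∃ A B, MvPolynomial.aeval ![p.1, p.2] B ≠ 0 ∧ x * toF G B = toF G A ∧
    MvPolynomial.aeval ![p.1, p.2] A = v * MvPolynomial.aeval ![p.1, p.2] B

section HasValue

variable {p : ℂ × ℂ} {x y : FunctionField G} {v w : ℂ}

lemma hasValue_toF (H : MvPolynomial (Fin 2) ℂ) :
    HasValue p (toF G H) (MvPolynomial.aeval ![p.1, p.2] H) :=
  ⟨H, 1, by simp⟩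

lemma HasValue.add (hx : HasValue p x v) (hy : HasValue p y w) : HasValue p (x + y) (v + w) := by
  obtain ⟨A, B, hB, h1, h2⟩ := hx
  obtain ⟨A', B', hB', h1', h2'⟩ := hy
  refine ⟨A * B' + A' * B, B * B', by rw [map_mul]; exact mul_ne_zero hB hB', ?_, ?_⟩
  · simp only [map_add, map_mul]
    linear_combination toF G B' * h1 + toF G B * h1'
  · simp only [map_add, map_mul, h2, h2']
    ring

lemma HasValue.mul (hx : HasValue p x v) (hy : HasValue p y w) : HasValue p (x * y) (v * w) := by
  obtain ⟨A, B, hB, h1, h2⟩ := hx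
  obtain ⟨A', B', hB', h1', h2'⟩ := hy
  refine ⟨A * A', B * B', by rw [map_mul]; exact mul_ne_zero hB hB', ?_, ?_⟩
  · simp only [map_mul]
    rw [← h1, ← h1']
    ring
  · simp only [map_mul, h2, h2']
    ring

lemma HasValue.unique (hp : p ∈ points ℂ G) (hx : HasValue p x v) (hx' : HasValue p x w) :
    v = w := by
  obtain ⟨A, B, hB, h1, h2⟩ := hx
  obtain ⟨A', B', hB', h1', h2'⟩ := hx'
  have h : toF G (A * B' - A' * B) = 0 := by
    simp only [map_sub, map_mul]
    rw [← h1, ← h1']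
    ring
  have := aeval_eq_zero_of_toF h hp
  simp only [map_sub, map_mul, h2, h2'] at this
  have h3 : (v - w) *
      (MvPolynomial.aeval ![p.1, p.2] B * MvPolynomial.aeval ![p.1, p.2] B') = 0 := by
    linear_combination this
  exact sub_eq_zero.1 ((mul_eq_zero.1 h3).resolve_right (mul_ne_zero hB hB'))

lemma HasValue.aeval (hx : HasValue p x v) (P : Polynomial ℂ) :
    HasValue p (Polynomial.aeval x P) (Polynomial.aeval v P) := by
  have hC : ∀ c : ℂ, HasValue (G := G) p (algebraMap ℂ _ c) c := fun c => by
    simpa [← MvPolynomial.algebraMap_eq] using hasValue_toF (G := G) (p := p) (MvPolynomial.C c)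
  induction P using Polynomial.induction_on with
  | C a => simpa using hC a
  | add P Q hP hQ => simpa using hP.add hQ
  | monomial n a h =>
    have := h.mul hx
    simp only [map_mul, map_pow, Polynomial.aeval_X, Polynomial.aeval_C] at this ⊢
    simpa [pow_succ, mul_assoc] using this

end HasValue

variable [IsDomain (CoordRing G)]

lemma exists_toF_div (x : FunctionField G) : ∃ A B, toF G B ≠ 0 ∧ x = toF G A / toF G B := by
  obtain ⟨a, b, hb, rfl⟩ := IsFractionRing.div_surjective (A := CoordRing G) x
  obtain ⟨A, rfl⟩ := Ideal.Quotient.mk_surjective a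
  obtain ⟨B, rfl⟩ := Ideal.Quotient.mk_surjective b
  refine ⟨A, B, ?_, rfl⟩
  rw [toF_apply]
  exact IsFractionRing.to_map_ne_zero_of_mem_nonZeroDivisors hb

lemma conjFunctionField_conj (x : FunctionField G) :
    conjFunctionField G (conjFunctionField G x) = x := by
  obtain ⟨A, B, -, rfl⟩ := exists_toF_div x
  have h : ∀ H : MvPolynomial (Fin 2) ℂ,
      MvPolynomial.map (starRingEnd ℂ) (MvPolynomial.map (starRingEnd ℂ) H) = H := by
    intro H
    rw [MvPolynomial.map_map, show (starRingEnd ℂ).comp (starRingEnd ℂ) = RingHom.id ℂ by ext; simp,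
      MvPolynomial.map_id]
  simp only [map_div₀, conjFunctionField_toF, h]

lemma IsGen.conjFunctionField {r : FunctionField G} (hr : IsGen ℂ r) :
    IsGen ℂ (conjFunctionField G r) := by
  refine ⟨?_, ?_⟩
  · rw [transcendental_iff]
    intro p hp
    have h := congrArg (TrigCurve.conjFunctionField G) hp
    rw [conjFunctionField_aeval, conjFunctionField_conj, map_zero] at h
    have := transcendental_iff.1 hr.transcendental _ h
    rwa [Polynomial.map_eq_zero] at this
  · rw [eq_top_iff]
    intro x _
    obtain ⟨p, q, -, -, h⟩ := hr.exists_div (TrigCurve.conjFunctionField G x)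
    refine (IntermediateField.mem_adjoin_simple_iff ℂ x).2
      ⟨p.map (starRingEnd ℂ), q.map (starRingEnd ℂ), ?_⟩
    rw [← conjFunctionField_aeval, ← conjFunctionField_aeval, ← map_div₀, ← h,
      conjFunctionField_conj]

lemma mem_conjPlace {V : ValuationSubring (FunctionField G)} {x : FunctionField G} :
    x ∈ conjPlace G V ↔ conjFunctionField G x ∈ V := Iff.rfl

lemma conjPlace_conjPlace (V : ValuationSubring (FunctionField G)) :
    conjPlace G (conjPlace G V) = V := by
  ext x
  rw [mem_conjPlace, mem_conjPlace, conjFunctionField_conj]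

lemma IsPlace.conjPlace {V : ValuationSubring (FunctionField G)} (hV : IsPlace ℂ V) :
    IsPlace ℂ (conjPlace G V) := fun c => by
  rw [mem_conjPlace, conjFunctionField_algebraMap]
  exact hV _

lemma mem_branchesAtInfinity {V : ValuationSubring (FunctionField G)} :
    V ∈ branchesAtInfinity G ↔ IsPlace ℂ V ∧ ¬ (coord G 0 ∈ V ∧ coord G 1 ∈ V) := Iff.rfl

lemma ne_top_of_mem_branchesAtInfinity {V : ValuationSubring (FunctionField G)}
    (hV : V ∈ branchesAtInfinity G) : V ≠ ⊤ := by
  rintro rfl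
  exact hV.2 ⟨ValuationSubring.mem_top _, ValuationSubring.mem_top _⟩

lemma conjFunctionField_lev {u : (FunctionField G)ˣ}
    (hu : conjFunctionField G (u : FunctionField G) = (u : FunctionField G)⁻¹) (f : ℂ[T;T⁻¹]) :
    conjFunctionField G (lev u f) = lev u (lconj f) := by
  induction f using LaurentPolynomial.induction_on' with
  | add p q hp hq => simp [hp, hq]
  | C_mul_T n a =>
    rw [lconj_C_mul_T, lev_apply, lev_apply, eval₂_C_mul_T, eval₂_C_mul_T, map_mul,
      conjFunctionField_algebraMap]
    congr 1
    simp [hu]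

lemma irreducible_complexify (hG : G ≠ 0) : Irreducible (complexify G) := by
  have h0 : complexify G ≠ 0 := by
    exact (map_ne_zero_iff _ (MvPolynomial.map_injective _ (algebraMap ℝ ℂ).injective)).2 hG
  have : (Ideal.span {complexify G}).IsPrime :=
    (Ideal.Quotient.isDomain_iff_prime _).1 ‹IsDomain (CoordRing G)›
  exact ((Ideal.span_singleton_prime h0).1 this).irreducible

/-- A nonzero function on the curve has finitely many zeros. -/
lemma finite_zeros (hG : G ≠ 0) {H : MvPolynomial (Fin 2) ℂ} (hH : toF G H ≠ 0) :
    {p ∈ points ℂ G | MvPolynomial.aeval ![p.1, p.2] H = 0}.Finite := by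
  refine (finite_common_zeros (irreducible_complexify hG)
    fun h => hH (toF_eq_zero.2 h)).subset ?_
  rintro p ⟨hp, hp'⟩
  exact ⟨by rw [aeval_complexify]; exact hp, hp'⟩

end FunctionField

end

section

/-! ### From two conjugate places at infinity to a Laurent parametrization -/

open scoped ComplexConjugate
open LaurentPolynomial

section

variable {G : MvPolynomial (Fin 2) ℝ} [IsDomain (CoordRing G)]

/-- For distinct conjugate places, a generator `φ` with its zero at one and its pole at the other
satisfies `σ φ = a / φ` with `a` real, because `σ φ` and `φ⁻¹` have the same pole and the same
zero. -/
lemma exists_isGen_conj_eq {V : ValuationSubring (FunctionField G)}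
    (hne : V ≠ conjPlace G V) (hV : IsPlace ℂ V) (htop : V ≠ ⊤) {r₀ : FunctionField G}
    (hr₀ : IsGen ℂ r₀) :
    ∃ (φ : FunctionField G) (a : ℝ), IsGen ℂ φ ∧ V.valuation φ < 1 ∧
      (conjPlace G V).valuation φ⁻¹ < 1 ∧ a ≠ 0 ∧
      conjFunctionField G φ = algebraMap ℂ _ (a : ℂ) * φ⁻¹ := by
  have htop' : conjPlace G V ≠ ⊤ := by
    intro h
    refine htop (eq_top_iff.2 fun x _ => ?_)
    have : conjFunctionField G x ∈ conjPlace G V := h ▸ ValuationSubring.mem_top _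
    rwa [mem_conjPlace, conjFunctionField_conj] at this
  obtain ⟨φ, hφ, hV0, hV1⟩ := hV.exists_isGen_zero_pole hV.conjPlace htop htop' hne hr₀
  have hφ0 := hφ.ne_zero
  have hinvV : φ⁻¹ ∉ V := by
    refine notMem_of_valuation_inv_lt_one (inv_ne_zero hφ0) ?_
    rwa [inv_inv]
  have hφV' : φ ∉ conjPlace G V := notMem_of_valuation_inv_lt_one hφ0 hV1
  have hiff : ∀ W : ValuationSubring (FunctionField G), IsPlace ℂ W →
      (φ⁻¹ ∈ W ↔ conjFunctionField G φ ∈ W) := by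
    intro W hW
    have h1 : φ⁻¹ ∈ W ↔ W ≠ V := by
      refine ⟨fun h hWV => hinvV (hWV ▸ h), fun h => by_contra fun hn => h ?_⟩
      exact hW.eq_of_valuation_lt_one hV hφ (by simpa using valuation_inv_lt_one hn) hV0
    have h2 : conjFunctionField G φ ∈ W ↔ W ≠ V := by
      rw [← mem_conjPlace]
      refine ⟨fun h hWV => hφV' (hWV ▸ h), fun h => by_contra fun hn => h ?_⟩
      rw [← conjPlace_conjPlace W, ← conjPlace_conjPlace V]
      congr 1
      exact hW.conjPlace.eq_of_valuation_lt_one hV.conjPlace hφ.inv (valuation_inv_lt_one hn) hV1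
    rw [h1, h2]
  obtain ⟨a, b, ha, hab⟩ := hφ.inv.exists_affine hφ.conjFunctionField hiff
  -- `σ φ` and `φ⁻¹` both vanish at the conjugate place
  have hb : b = 0 := by
    by_contra hb
    have h1 : (conjPlace G V).valuation (conjFunctionField G φ) = 1 := by
      have := hV.conjPlace.valuation_aeval hV1
        (p := Polynomial.C a * Polynomial.X + Polynomial.C b) (by simpa using hb)
      rwa [map_add, map_mul, Polynomial.aeval_C, Polynomial.aeval_C, Polynomial.aeval_X, ← hab]
        at this
    have h2 : (conjFunctionField G φ)⁻¹ ∉ conjPlace G V := by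
      rw [mem_conjPlace, map_inv₀, conjFunctionField_conj]
      exact hinvV
    have h3 := valuation_inv_lt_one h2
    rw [inv_inv, h1] at h3
    exact lt_irrefl _ h3
  rw [hb, map_zero, add_zero] at hab
  -- conjugation is an involution
  have hreal : conj a = a := by
    have h := congrArg (conjFunctionField G) hab
    rw [conjFunctionField_conj, map_mul, conjFunctionField_algebraMap, map_inv₀, hab] at h
    have ha' : algebraMap ℂ (FunctionField G) a ≠ 0 := by simpa using ha
    refine (algebraMap ℂ (FunctionField G)).injective ?_
    field_simp at h
    exact h.symm
  refine ⟨φ, a.re, hφ, hV0, hV1, ?_, ?_⟩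
  · intro h
    rw [← Complex.conj_eq_iff_re.1 hreal, h] at ha
    simp at ha
  · rw [Complex.conj_eq_iff_re.1 hreal, hab]

/-- Evaluating `φ · σ φ = a` at a real point of the curve shows that `a` is the square of an
absolute value. -/
lemma pos_of_conj_eq (hG : G ≠ 0) (hinf : (points ℝ G).Infinite) {φ : FunctionField G} {a : ℝ}
    (hφ0 : φ ≠ 0) (ha : a ≠ 0)
    (hφ : conjFunctionField G φ = algebraMap ℂ _ (a : ℂ) * φ⁻¹) : 0 < a := by
  obtain ⟨A, B, hB, rfl⟩ := exists_toF_div φ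
  let ι : ℝ × ℝ → ℂ × ℂ := fun p => ((p.1 : ℂ), (p.2 : ℂ))
  have hι : Function.Injective ι := by
    rintro ⟨a, b⟩ ⟨c, d⟩ h
    simpa [ι] using h
  obtain ⟨p, hp, hpB⟩ := (hinf.sdiff ((finite_zeros hG hB).preimage hι.injOn)).nonempty
  have hpC : ι p ∈ points ℂ G := ofReal_mem_points.2 hp
  have hBp : MvPolynomial.aeval ![(p.1 : ℂ), (p.2 : ℂ)] B ≠ 0 := fun h => hpB ⟨hpC, h⟩
  have hA : toF G A ≠ 0 := fun h => hφ0 (by rw [h, zero_div])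
  have hB' : toF G (MvPolynomial.map (starRingEnd ℂ) B) ≠ 0 := by
    rw [← conjFunctionField_toF]
    exact (map_ne_zero _).2 hB
  rw [map_div₀, conjFunctionField_toF, conjFunctionField_toF] at hφ
  have h0 : toF G (MvPolynomial.map (starRingEnd ℂ) A * A -
      MvPolynomial.C (a : ℂ) * (MvPolynomial.map (starRingEnd ℂ) B * B)) = 0 := by
    have hC : toF G (MvPolynomial.C (a : ℂ)) = algebraMap ℂ _ (a : ℂ) := by
      rw [← MvPolynomial.algebraMap_eq, AlgHom.commutes]
    rw [map_sub, map_mul, map_mul, map_mul, hC, sub_eq_zero]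
    field_simp at hφ
    linear_combination hφ
  have h1 := aeval_eq_zero_of_toF h0 hpC
  have hconj : ∀ H, MvPolynomial.aeval ![(p.1 : ℂ), (p.2 : ℂ)]
      (MvPolynomial.map (starRingEnd ℂ) H) =
        conj (MvPolynomial.aeval ![(p.1 : ℂ), (p.2 : ℂ)] H) := by
    intro H
    rw [conj_aeval]
    congr 2
    ext i; fin_cases i <;> simp
  simp only [ι, map_sub, map_mul, hconj, MvPolynomial.aeval_C, ← Complex.normSq_eq_conj_mul_self,
    Algebra.algebraMap_self, RingHom.id_apply] at h1
  have h2 : Complex.normSq (MvPolynomial.aeval ![(p.1 : ℂ), (p.2 : ℂ)] A) =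
      a * Complex.normSq (MvPolynomial.aeval ![(p.1 : ℂ), (p.2 : ℂ)] B) := by
    exact_mod_cast sub_eq_zero.1 h1
  have h3 := Complex.normSq_pos.2 hBp
  have h4 := Complex.normSq_nonneg (MvPolynomial.aeval ![(p.1 : ℂ), (p.2 : ℂ)] A)
  rw [h2] at h4
  exact lt_of_le_of_ne (nonneg_of_mul_nonneg_left h4 h3) ha.symm

/-- A rational curve with two conjugate places at infinity and infinitely many real points has a
coordinate `φ` with `σ φ = φ⁻¹` in which `x` and `y` are self-conjugate Laurent polynomials. -/
lemma exists_lp_eq_coord (hG : G ≠ 0) (hinf : (points ℝ G).Infinite)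
    {V : ValuationSubring (FunctionField G)} (hne : V ≠ conjPlace G V)
    (hbr : branchesAtInfinity G = {V, conjPlace G V}) {r₀ : FunctionField G} (hr₀ : IsGen ℂ r₀) :
    ∃ (u : (FunctionField G)ˣ) (P Q : Polynomial ℂ), IsGen ℂ (u : FunctionField G) ∧
      lev u (lp P) = coord G 0 ∧ lev u (lp Q) = coord G 1 := by
  have hVb : V ∈ branchesAtInfinity G := hbr ▸ Set.mem_insert V _
  have hV := (mem_branchesAtInfinity.1 hVb).1
  obtain ⟨φ, a, hφ, hV0, hV1, ha, hconj⟩ :=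
    exists_isGen_conj_eq hne hV (ne_top_of_mem_branchesAtInfinity hVb) hr₀
  have hpos := pos_of_conj_eq hG hinf hφ.ne_zero ha hconj
  -- rescaling turns `σ φ = a / φ` into `σ φ = 1 / φ`
  have hs0 : ((Real.sqrt a)⁻¹ : ℂ) ≠ 0 := by
    simpa using (Real.sqrt_pos.2 hpos).ne'
  have hgen : IsGen ℂ (algebraMap ℂ _ ((Real.sqrt a)⁻¹ : ℂ) * φ) := by
    simpa using hφ.affine hs0 0
  obtain ⟨u, hu⟩ : ∃ u : (FunctionField G)ˣ,
      (u : FunctionField G) = algebraMap ℂ _ ((Real.sqrt a)⁻¹ : ℂ) * φ :=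
    ⟨Units.mk0 _ hgen.ne_zero, rfl⟩
  have hsq : (Real.sqrt a : ℂ) * Real.sqrt a = a := by
    exact_mod_cast Real.mul_self_sqrt hpos.le
  have huconj : conjFunctionField G (u : FunctionField G) = (u : FunctionField G)⁻¹ := by
    have hφ0 := hφ.ne_zero
    rw [hu, map_mul, conjFunctionField_algebraMap, hconj, ← hsq, mul_inv, ← map_inv₀, inv_inv,
      ← mul_assoc, ← map_mul, map_inv₀, Complex.conj_ofReal]
    congr 2
    have : (Real.sqrt a : ℂ) ≠ 0 := by simpa using hs0
    field_simp
  have hlev : ∀ i, ∃ f, lev u f = coord G i := by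
    intro i
    refine IsGen.exists_lev_eq (hu ▸ hgen) fun W hW h1 h2 => by_contra fun hn => ?_
    have hWφ : φ ∈ W := by
      have := W.mul_mem _ _ (hW (Real.sqrt a : ℂ)) h1
      rw [hu, ← mul_assoc, ← map_mul, mul_inv_cancel₀ (by simpa using hs0), map_one, one_mul]
        at this
      exact this
    have hWφ' : φ⁻¹ ∈ W := by
      have := W.mul_mem _ _ (hW ((Real.sqrt a)⁻¹ : ℂ)) h2
      rw [hu, mul_inv, ← mul_assoc, ← map_inv₀, ← map_mul, mul_inv_cancel₀ hs0, map_one, one_mul]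
        at this
      exact this
    have hWb : W ∈ branchesAtInfinity G := by
      refine ⟨hW, fun h => hn ?_⟩
      fin_cases i
      · exact h.1
      · exact h.2
    rw [hbr] at hWb
    rcases hWb with rfl | hWb
    · exact notMem_of_valuation_inv_lt_one (inv_ne_zero hφ.ne_zero) (by rwa [inv_inv]) hWφ'
    · rw [Set.mem_singleton_iff] at hWb
      subst hWb
      exact notMem_of_valuation_inv_lt_one hφ.ne_zero hV1 hWφ
  have hlp : ∀ i, ∃ P, lev u (lp P) = coord G i := by
    intro i
    obtain ⟨f, hf⟩ := hlev i
    have hfix : lconj f = f := by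
      refine lev_injective (hu ▸ hgen).transcendental ?_
      rw [← conjFunctionField_lev huconj, hf, conjFunctionField_coord]
    obtain ⟨P, rfl⟩ := exists_eq_lp hfix
    exact ⟨P, hf⟩
  obtain ⟨P, hP⟩ := hlp 0
  obtain ⟨Q, hQ⟩ := hlp 1
  exact ⟨u, P, Q, hu ▸ hgen, hP, hQ⟩

/-- An isomorphism of function fields given by Laurent polynomials is generically bijective on
points. -/
lemma isGenericParam_of_lev_eq_coord (hG : G ≠ 0) {u : (FunctionField G)ˣ} {P Q : Polynomial ℂ}
    (hu : IsGen ℂ (u : FunctionField G)) (hP : lev u (lp P) = coord G 0)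
    (hQ : lev u (lp Q) = coord G 1) : IsGenericParam (lpt P Q) Set.univ (points ℂ G) := by
  have hinj := lev_injective hu.transcendental
  have hF : ∀ H, lev u (MvPolynomial.aeval ![lp P, lp Q] H) = toF G H := by
    intro H
    rw [toF_eq_aeval, ← AlgHom.comp_apply, MvPolynomial.comp_aeval]
    congr 2
    ext i; fin_cases i <;> simp [hP, hQ]
  have hz : ∀ (z : ℂˣ) (H : MvPolynomial (Fin 2) ℂ), lev z (MvPolynomial.aeval ![lp P, lp Q] H) =
      MvPolynomial.aeval ![(lpt P Q z).1, (lpt P Q z).2] H := by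
    intro z H
    rw [← AlgHom.comp_apply, MvPolynomial.comp_aeval]
    congr 2
    ext i; fin_cases i <;> simp [lpt]
  obtain ⟨A, B, hB, hAB⟩ := exists_toF_div (u : FunctionField G)
  have hA : toF G A ≠ 0 := fun h => hu.ne_zero (by rw [hAB, h, zero_div])
  have huAB : (u : FunctionField G) * toF G B = toF G A := by
    rw [hAB, div_mul_cancel₀ _ hB]
  refine ⟨?_, ?_, {z | lev z (MvPolynomial.aeval ![lp P, lp Q] B) = 0}, ?_, ?_⟩
  · intro z _
    have h0 : MvPolynomial.aeval ![lp P, lp Q] (complexify G) = 0 := by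
      refine hinj ?_
      rw [hF, map_zero]
      exact toF_eq_zero.2 dvd_rfl
    change MvPolynomial.aeval _ G = 0
    rw [← aeval_complexify, ← hz, h0, map_zero]
  -- away from the zeros of `A` and `B`, the point `p` has the parameter `A(p) / B(p)`
  · refine ((finite_zeros hG hA).union (finite_zeros hG hB)).subset ?_
    rintro p ⟨hp, hp'⟩
    by_contra hcon
    simp only [Set.mem_union, Set.mem_ofPred_eq, not_or, not_and] at hcon
    have hAp := hcon.1 hp
    have hBp := hcon.2 hp
    let z : ℂˣ := Units.mk0 _ (div_ne_zero hAp hBp)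
    have hzv : (z : ℂ) = MvPolynomial.aeval ![p.1, p.2] A / MvPolynomial.aeval ![p.1, p.2] B := rfl
    have hval : HasValue p (u : FunctionField G) (z : ℂ) :=
      ⟨A, B, hBp, huAB, by rw [hzv, div_mul_cancel₀ _ hBp]⟩
    have hval' : HasValue p ((u⁻¹ : (FunctionField G)ˣ) : FunctionField G) ((z⁻¹ : ℂˣ) : ℂ) := by
      refine ⟨B, A, hAp, by rw [← huAB, Units.inv_mul_cancel_left], ?_⟩
      rw [Units.val_inv_eq_inv_val, hzv]
      field_simp
    have hlp : ∀ P, HasValue p (lev u (lp P)) (lev z (lp P)) := fun P => by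
      rw [lev_lp, lev_lp]
      exact (hval.aeval P).add (hval'.aeval _)
    have hx : ∀ i, HasValue p (coord G i) (![p.1, p.2] i) := fun i => by
      have := hasValue_toF (G := G) (p := p) (MvPolynomial.X i)
      rwa [MvPolynomial.aeval_X, toF_X] at this
    refine hp' ⟨z, trivial, Prod.ext ?_ ?_⟩
    · exact HasValue.unique hp (hP ▸ hlp P) (hx 0)
    · exact HasValue.unique hp (hQ ▸ hlp Q) (hx 1)
  · refine finite_lev_eq_zero fun h => hB ?_
    rw [← hF, h, map_zero]
  · have hL : T 1 * MvPolynomial.aeval ![lp P, lp Q] B = MvPolynomial.aeval ![lp P, lp Q] A := by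
      refine hinj ?_
      rw [map_mul, hF, hF, ← huAB, lev_T, zpow_one]
    have hzz : ∀ z : ℂˣ, z * MvPolynomial.aeval ![(lpt P Q z).1, (lpt P Q z).2] B =
        MvPolynomial.aeval ![(lpt P Q z).1, (lpt P Q z).2] A := by
      intro z
      rw [← hz, ← hz, ← hL, map_mul, lev_T, zpow_one]
    intro z hzE w _ h
    have hBz : MvPolynomial.aeval ![(lpt P Q z).1, (lpt P Q z).2] B ≠ 0 := by
      rw [← hz]; exact hzE.2
    refine Units.ext (mul_right_cancel₀ hBz ?_)
    rw [hzz, h, hzz]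

end

end

section

/-! ### The equation of a trigonometric curve -/

open scoped ComplexConjugate
open LaurentPolynomial

/-- A continuous real function on a circle takes almost all values between two of its values at
least twice. -/
lemma not_injOn_of_periodic {g : ℝ → ℝ} {a b : ℝ} (hab : a < b) (hg : Continuous g)
    (hper : g a = g b) {E : Set ℝ} (hE : E.Finite) : ¬ Set.InjOn g (Set.Ico a b \ E) := by
  intro hinj
  obtain ⟨m, hm, hne⟩ : ∃ m ∈ Set.Ioo a b, g m ≠ g a := by
    by_contra! hcon
    have hinf : (Set.Ioo a b \ E).Infinite := (Set.Ioo_infinite hab).sdiff hE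
    obtain ⟨s, hs⟩ := hinf.nonempty
    obtain ⟨t, ht, hts⟩ := (hinf.sdiff (Set.finite_singleton s)).nonempty
    exact hts (hinj ⟨Set.Ioo_subset_Ico_self ht.1, ht.2⟩ ⟨Set.Ioo_subset_Ico_self hs.1, hs.2⟩
      ((hcon t ht.1).trans (hcon s hs.1).symm))
  have hlt : min (g a) (g m) < max (g a) (g m) := by
    rcases lt_or_gt_of_ne hne with h | h <;> simp [h]
  obtain ⟨y, hy, hyE⟩ := ((Set.Ioo_infinite hlt).sdiff (hE.image g)).nonempty
  have hya : y ≠ g a := by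
    rintro rfl
    rcases lt_or_gt_of_ne hne with h | h <;> simp [h, h.le] at hy
  have hym : y ≠ g m := by
    rintro rfl
    rcases lt_or_gt_of_ne hne with h | h <;> simp [h, h.le] at hy
  have hy' : y ∈ Set.uIcc (g a) (g m) := Set.Ioo_subset_Icc_self hy
  obtain ⟨s, hs, hsy⟩ := intermediate_value_uIcc (hg.continuousOn (s := Set.uIcc a m)) hy'
  obtain ⟨t, ht, hty⟩ := intermediate_value_uIcc (hg.continuousOn (s := Set.uIcc m b))
    (by rw [← hper, Set.uIcc_comm]; exact hy')
  rw [Set.uIcc_of_le hm.1.le] at hs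
  rw [Set.uIcc_of_le hm.2.le] at ht
  have hsm : s < m := lt_of_le_of_ne hs.2 (by rintro rfl; exact hym hsy.symm)
  have htb : t < b := lt_of_le_of_ne ht.2 (by rintro rfl; exact hya (hper ▸ hty.symm))
  have : s = t := hinj ⟨⟨hs.1, hsm.trans hm.2⟩, fun h => hyE ⟨s, h, hsy⟩⟩
    ⟨⟨hm.1.le.trans ht.1, htb⟩, fun h => hyE ⟨t, h, hty⟩⟩ (hsy.trans hty.symm)
  linarith [ht.1]

/-- The decomposition into real and imaginary parts of the coefficients. -/
lemma exists_complexify_add (H : MvPolynomial (Fin 2) ℂ) :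
    ∃ A B, H = complexify A + MvPolynomial.C Complex.I * complexify B := by
  induction H using MvPolynomial.induction_on with
  | C a =>
    refine ⟨MvPolynomial.C a.re, MvPolynomial.C a.im, ?_⟩
    simp only [complexify, MvPolynomial.map_C, ← map_mul, ← map_add]
    congr 1
    rw [mul_comm]
    exact (Complex.re_add_im a).symm
  | add p q hp hq =>
    obtain ⟨A, B, rfl⟩ := hp
    obtain ⟨A', B', rfl⟩ := hq
    exact ⟨A + A', B + B', by simp only [complexify, map_add]; ring⟩
  | mul_X p i hp =>
    obtain ⟨A, B, rfl⟩ := hp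
    exact ⟨A * MvPolynomial.X i, B * MvPolynomial.X i, by
      simp only [complexify, map_mul, MvPolynomial.map_X]; ring⟩

section Kernel

variable {G : MvPolynomial (Fin 2) ℝ} {P Q : Polynomial ℂ}

/-- The real points parametrized by the unit circle. -/
def rpt (P Q : Polynomial ℂ) (t : ℝ) : ℝ × ℝ :=
  ((lev (cis t) (lp P)).re, (lev (cis t) (lp Q)).re)

lemma lev_cis_aeval_complexify (t : ℝ) (H : MvPolynomial (Fin 2) ℝ) :
    lev (cis t) (MvPolynomial.aeval ![lp P, lp Q] (complexify H)) =
      (MvPolynomial.aeval ![(rpt P Q t).1, (rpt P Q t).2] H : ℝ) := by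
  have h := MvPolynomial.aeval_algebraMap_apply ℂ ![(rpt P Q t).1, (rpt P Q t).2] H
  rw [← AlgHom.comp_apply, MvPolynomial.comp_aeval, aeval_complexify]
  refine Eq.trans ?_ h
  congr 2
  ext i
  fin_cases i <;> simp [rpt, lev_cis_real (lconj_lp _)]

/-- The ideal of the real polynomials that vanish on the parametrized curve. -/
def realKer (P Q : Polynomial ℂ) : Ideal (MvPolynomial (Fin 2) ℝ) :=
  RingHom.ker ((MvPolynomial.aeval ![lp P, lp Q] :
    MvPolynomial (Fin 2) ℂ →ₐ[ℂ] ℂ[T;T⁻¹]).toRingHom.comp (MvPolynomial.map (algebraMap ℝ ℂ)))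

instance : (realKer P Q).IsPrime := RingHom.ker_isPrime _

lemma mem_realKer {H : MvPolynomial (Fin 2) ℝ} :
    H ∈ realKer P Q ↔ MvPolynomial.aeval ![lp P, lp Q] (complexify H) = 0 := Iff.rfl

lemma mem_realKer_iff {H : MvPolynomial (Fin 2) ℝ} :
    H ∈ realKer P Q ↔ ∀ t ∈ Set.Ico 0 (2 * Real.pi), rpt P Q t ∈ points ℝ H := by
  rw [mem_realKer]
  constructor
  · intro h t _
    have := lev_cis_aeval_complexify (P := P) (Q := Q) t H
    rw [h, map_zero] at this
    exact_mod_cast this.symm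
  · intro h
    by_contra h0
    refine (Set.Ico_infinite (show (0 : ℝ) < 2 * Real.pi by positivity)).image cis_injOn
      ((finite_lev_eq_zero h0).subset ?_)
    rintro _ ⟨t, ht, rfl⟩
    rw [Set.mem_ofPred_eq, lev_cis_aeval_complexify, mem_points.1 (h t ht)]
    simp

variable (h : IsGenericParam (rpt P Q) (Set.Ico 0 (2 * Real.pi)) (points ℝ G))
include h

lemma infinite_image_rpt : (rpt P Q '' Set.Ico 0 (2 * Real.pi)).Infinite := by
  obtain ⟨-, -, E, hE, hinj⟩ := h
  exact ((((Set.Ico_infinite (by positivity)).sdiff hE).image hinj).mono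
    (Set.image_mono Set.sdiff_subset))

lemma dvd_of_mem_realKer {F H : MvPolynomial (Fin 2) ℝ} (hF : Irreducible F)
    (hFk : F ∈ realKer P Q) (hHk : H ∈ realKer P Q) : F ∣ H := by
  by_contra hn
  refine infinite_image_rpt h ((finite_common_zeros hF hn).subset ?_)
  rintro _ ⟨t, ht, rfl⟩
  exact ⟨mem_realKer_iff.1 hFk t ht, mem_realKer_iff.1 hHk t ht⟩

/-- Since the real points of `G` are parametrized up to finitely many, every factor of `G` with
infinitely many real points is the equation of the parametrized curve; the visibility assumption
disposes of the others. -/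
lemma irreducible_of_isGenericParam (hG : Squarefree G)
    (hvis : ∀ H : MvPolynomial (Fin 2) ℝ, Irreducible H → H ∣ G →
      (points ℝ H).Finite → Associated H G) : Irreducible G := by
  have hG0 : G ≠ 0 := hG.ne_zero
  have hGk : G ∈ realKer P Q := mem_realKer_iff.2 fun t ht => h.mapsTo ht
  obtain ⟨H, hHk, hH⟩ := Ideal.IsPrime.exists_mem_prime_of_ne_bot
    (inferInstance : (realKer P Q).IsPrime) (fun hb => hG0 (by rwa [hb] at hGk))
  have hHi := hH.irreducible
  obtain ⟨K, rfl⟩ := dvd_of_mem_realKer h hHi hHk hGk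
  by_cases hK : IsUnit K
  · exact (irreducible_mul_isUnit hK).2 hHi
  exfalso
  obtain ⟨H', hH', hH'K⟩ := WfDvdMonoid.exists_irreducible_factor hK (right_ne_zero_of_mul hG0)
  have hdvd : ¬ H ∣ H' := fun hd => hHi.not_isUnit (hG H (mul_dvd_mul_left H (hd.trans hH'K)))
  by_cases hfin : (points ℝ H').Finite
  · exact hdvd ((dvd_mul_right H K).trans (hvis H' hH' (hH'K.mul_left H) hfin).symm.dvd)
  · refine hfin (((finite_common_zeros hHi hdvd).union h.cofinite).subset fun p hp => ?_)
    by_cases hpi : p ∈ rpt P Q '' Set.Ico 0 (2 * Real.pi)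
    · obtain ⟨t, ht, rfl⟩ := hpi
      exact Or.inl ⟨mem_realKer_iff.1 hHk t ht, hp⟩
    · refine Or.inr ⟨?_, hpi⟩
      obtain ⟨L, rfl⟩ := hH'K
      change MvPolynomial.aeval _ _ = 0
      rw [map_mul, map_mul, mem_points.1 hp, zero_mul, mul_zero]

/-- The kernel over `ℂ` is generated by `G` as well: the real and imaginary parts of a polynomial
vanishing on the curve vanish at the real points of the unit circle. -/
lemma aeval_lp_eq_zero_iff (hG : Irreducible G) {H : MvPolynomial (Fin 2) ℂ} :
    MvPolynomial.aeval ![lp P, lp Q] H = 0 ↔ complexify G ∣ H := by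
  have hGk : G ∈ realKer P Q := mem_realKer_iff.2 fun t ht => h.mapsTo ht
  constructor
  · intro hH
    obtain ⟨A, B, rfl⟩ := exists_complexify_add H
    have key : ∀ t, MvPolynomial.aeval ![(rpt P Q t).1, (rpt P Q t).2] A = 0 ∧
        MvPolynomial.aeval ![(rpt P Q t).1, (rpt P Q t).2] B = 0 := by
      intro t
      have := congrArg (lev (cis t)) hH
      rw [map_add, map_add, map_mul, map_mul, lev_cis_aeval_complexify, lev_cis_aeval_complexify,
        MvPolynomial.aeval_C, AlgHom.commutes, map_zero] at this
      have h1 := congrArg Complex.re this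
      have h2 := congrArg Complex.im this
      simp only [Algebra.algebraMap_self, RingHom.id_apply, Complex.add_re, Complex.add_im,
        Complex.mul_re, Complex.mul_im, Complex.I_re, Complex.I_im, Complex.ofReal_re,
        Complex.ofReal_im, Complex.zero_re, Complex.zero_im] at h1 h2
      constructor <;> linarith
    have hA : G ∣ A := dvd_of_mem_realKer h hG hGk (mem_realKer_iff.2 fun t _ => (key t).1)
    have hB : G ∣ B := dvd_of_mem_realKer h hG hGk (mem_realKer_iff.2 fun t _ => (key t).2)
    exact dvd_add (map_dvd _ hA) ((map_dvd (MvPolynomial.map (algebraMap ℝ ℂ)) hB).mul_left _)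
  · rintro ⟨H, rfl⟩
    rw [map_mul, mem_realKer.1 hGk, zero_mul]

lemma natDegree_ne_zero : P.natDegree ≠ 0 ∨ Q.natDegree ≠ 0 := by
  by_contra! hcon
  obtain ⟨c, hc⟩ := Polynomial.natDegree_eq_zero.1 hcon.1
  obtain ⟨d, hd⟩ := Polynomial.natDegree_eq_zero.1 hcon.2
  refine infinite_image_rpt h ((Set.finite_singleton (rpt P Q 0)).subset ?_)
  rintro _ ⟨t, -, rfl⟩
  simp [rpt, ← hc, ← hd, lev_lp]

end Kernel

end

section

/-! ### The places at infinity of a trigonometric curve -/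

open scoped ComplexConjugate
open LaurentPolynomial

/-- An element of a field over an algebraically closed field that has a pole is transcendental. -/
lemma IsPlace.transcendental_of_notMem {k F : Type*} [Field k] [IsAlgClosed k] [Field F]
    [Algebra k F] {V : ValuationSubring F} (hV : IsPlace k V) {x : F} (hx : x ∉ V) :
    Transcendental k x := by
  intro halg
  obtain ⟨c, rfl⟩ := minpoly.mem_range_of_degree_eq_one k x
    (IsAlgClosed.degree_eq_one_of_irreducible k (minpoly.irreducible halg.isIntegral))
  exact hx (hV c)

section

variable {G : MvPolynomial (Fin 2) ℝ} {P Q : Polynomial ℂ}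

/-- The variable of `ℂ(φ)`. -/
def ratX : (RatFunc ℂ)ˣ := Units.mk0 RatFunc.X RatFunc.X_ne_zero

lemma isGen_ratX : IsGen ℂ (ratX : RatFunc ℂ) := ⟨RatFunc.transcendental_X, RatFunc.adjoin_X⟩

lemma isDomain_coordRing
    (hker : ∀ H, MvPolynomial.aeval ![lp P, lp Q] H = 0 ↔ complexify G ∣ H) :
    IsDomain (CoordRing G) := by
  rw [Ideal.Quotient.isDomain_iff_prime]
  have : Ideal.span {complexify G} = RingHom.ker
      (MvPolynomial.aeval ![lp P, lp Q] : MvPolynomial (Fin 2) ℂ →ₐ[ℂ] ℂ[T;T⁻¹]) := by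
    ext H
    rw [Ideal.mem_span_singleton, RingHom.mem_ker]
    exact (hker H).symm
  rw [this]
  exact RingHom.ker_isPrime _

/-- The parametrization embeds the function field of the curve into `ℂ(φ)`. -/
lemma exists_functionField_algHom [IsDomain (CoordRing G)]
    (hker : ∀ H, MvPolynomial.aeval ![lp P, lp Q] H = 0 ↔ complexify G ∣ H) :
    ∃ j : FunctionField G →ₐ[ℂ] RatFunc ℂ,
      ∀ H, j (toF G H) = lev ratX (MvPolynomial.aeval ![lp P, lp Q] H) := by
  have hinj := lev_injective isGen_ratX.transcendental
  let g₀ : MvPolynomial (Fin 2) ℂ →ₐ[ℂ] RatFunc ℂ :=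
    (lev ratX).comp (MvPolynomial.aeval ![lp P, lp Q])
  have hg₀ : ∀ H, g₀ H = 0 ↔ complexify G ∣ H := fun H => by
    rw [← hker, AlgHom.comp_apply, map_eq_zero_iff _ hinj]
  let g : CoordRing G →ₐ[ℂ] RatFunc ℂ := Ideal.Quotient.liftₐ _ g₀ fun a ha =>
    (hg₀ a).2 (Ideal.mem_span_singleton.1 ha)
  have hg : Function.Injective g := by
    rw [injective_iff_map_eq_zero]
    intro a ha
    obtain ⟨H, rfl⟩ := Ideal.Quotient.mk_surjective a
    exact Ideal.Quotient.eq_zero_iff_mem.2 (Ideal.mem_span_singleton.2 ((hg₀ H).1 ha))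
  refine ⟨IsFractionRing.liftAlgHom (K := FunctionField G) hg, fun H => ?_⟩
  rw [toF_apply, IsFractionRing.liftAlgHom_apply]
  exact IsFractionRing.lift_algebraMap hg _

variable [IsDomain (CoordRing G)] {j : FunctionField G →ₐ[ℂ] RatFunc ℂ}

lemma IsPlace.comap {V : ValuationSubring (RatFunc ℂ)} (hV : IsPlace ℂ V) :
    IsPlace ℂ (V.comap (j : FunctionField G →+* RatFunc ℂ)) := fun c => by
  rw [ValuationSubring.mem_comap]
  exact (j.commutes c).symm ▸ hV c

/-- Conjugation on the function field is induced by the conjugation `φ ↦ φ⁻¹` of `ℂ(φ)`. -/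
lemma conj_comp_functionField {τ : RatFunc ℂ ≃+* RatFunc ℂ}
    (hτ : ∀ f, τ (lev ratX f) = lev ratX (lconj f))
    (hj : ∀ H, j (toF G H) = lev ratX (MvPolynomial.aeval ![lp P, lp Q] H))
    (x : FunctionField G) : j (conjFunctionField G x) = τ (j x) := by
  have hpoly : ∀ H : MvPolynomial (Fin 2) ℂ, MvPolynomial.aeval ![lp P, lp Q]
      (MvPolynomial.map (starRingEnd ℂ) H) = lconj (MvPolynomial.aeval ![lp P, lp Q] H) := by
    intro H
    induction H using MvPolynomial.induction_on with
    | C a =>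
      rw [MvPolynomial.map_C, MvPolynomial.aeval_C, MvPolynomial.aeval_C, ← C_eq_algebraMap,
        ← C_eq_algebraMap, lconj_C]
    | add p q hp hq => rw [map_add, map_add, map_add, map_add, hp, hq]
    | mul_X p i hp =>
      rw [map_mul, map_mul, map_mul, map_mul, hp, MvPolynomial.map_X, MvPolynomial.aeval_X]
      congr 1
      fin_cases i <;> simp [lconj_lp]
  obtain ⟨A, B, -, rfl⟩ := exists_toF_div x
  simp only [map_div₀, conjFunctionField_toF, hj, hτ, hpoly]

/-- Every place at infinity of the curve lies below the point `0` or the point `∞` of the parameter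
line. -/
lemma eq_comap_or_eq_comap
    (hj : ∀ H, j (toF G H) = lev ratX (MvPolynomial.aeval ![lp P, lp Q] H))
    {V₀ V₁ : ValuationSubring (RatFunc ℂ)} (hV₀ : IsPlace ℂ V₀) (hV₁ : IsPlace ℂ V₁)
    (h₀ : V₀.valuation (ratX : RatFunc ℂ) < 1) (h₁ : V₁.valuation (ratX : RatFunc ℂ)⁻¹ < 1)
    {s : FunctionField G} (hs : IsGen ℂ s) {W : ValuationSubring (FunctionField G)}
    (hW : W ∈ branchesAtInfinity G) :
    W = V₀.comap (j : FunctionField G →+* RatFunc ℂ) ∨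
      W = V₁.comap (j : FunctionField G →+* RatFunc ℂ) := by
  obtain ⟨r, hr, hWr⟩ :=
    IsPlace.exists_isGen (mem_branchesAtInfinity.1 hW).1 (ne_top_of_mem_branchesAtInfinity hW) hs
  -- `W` is the zero of `r`, so it lies below any zero `U` of `j r`
  have htr : Transcendental ℂ (j r) :=
    fun h => hr.transcendental ((isAlgebraic_algHom_iff j j.injective).1 h)
  obtain ⟨U, hU, hUr⟩ := exists_place_valuation_lt_one htr
  have hWU : W = U.comap (j : FunctionField G →+* RatFunc ℂ) := by
    refine IsPlace.eq_of_valuation_lt_one hW.1 hU.comap hr hWr ?_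
    have hn : r⁻¹ ∉ U.comap (j : FunctionField G →+* RatFunc ℂ) := by
      rw [ValuationSubring.mem_comap]
      change j r⁻¹ ∉ U
      rw [map_inv₀]
      exact notMem_of_valuation_inv_lt_one (inv_ne_zero (j.injective.ne_iff' (map_zero j) |>.2
        hr.ne_zero)) (by rwa [inv_inv])
    simpa using valuation_inv_lt_one hn
  by_cases hX : (ratX : RatFunc ℂ) ∈ U
  · by_cases hX' : (ratX : RatFunc ℂ)⁻¹ ∈ U
    · exfalso
      have hlp : ∀ P, lev ratX (lp P) ∈ U := fun P => by
        rw [lev_lp]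
        refine U.add_mem _ _ (hU.aeval_mem hX P) (hU.aeval_mem ?_ _)
        simpa using hX'
      refine hW.2 ?_
      rw [hWU, ValuationSubring.mem_comap, ValuationSubring.mem_comap]
      have h0 := hj (MvPolynomial.X 0)
      have h1 := hj (MvPolynomial.X 1)
      rw [toF_X, MvPolynomial.aeval_X] at h0 h1
      exact ⟨h0.symm ▸ hlp P, h1.symm ▸ hlp Q⟩
    · left
      rw [hWU, hU.eq_of_valuation_lt_one hV₀ isGen_ratX
        (by simpa using valuation_inv_lt_one hX') h₀]
  · right
    rw [hWU, hU.eq_of_valuation_lt_one hV₁ isGen_ratX.inv (valuation_inv_lt_one hX) h₁]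

/-- If there were only one place at infinity, then `x` and `y` would be polynomials in one
self-conjugate function, which restricts to a continuous real function on the unit circle; the
parametrization of the real points would not be generically injective. -/
lemma not_subsingleton_branches
    (h : IsGenericParam (rpt P Q) (Set.Ico 0 (2 * Real.pi)) (points ℝ G))
    (hj : ∀ H, j (toF G H) = lev ratX (MvPolynomial.aeval ![lp P, lp Q] H))
    {V : ValuationSubring (FunctionField G)} (hbr : branchesAtInfinity G = {V})
    (hconj : conjPlace G V = V) {s₀ : FunctionField G} (hs₀ : IsGen ℂ s₀) : False := by
  have hVb : V ∈ branchesAtInfinity G := hbr ▸ Set.mem_singleton V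
  have hV : IsPlace ℂ V := hVb.1
  obtain ⟨r, hr, hVr⟩ := hV.exists_isGen (ne_top_of_mem_branchesAtInfinity hVb) hs₀
  obtain ⟨s, hs, hsV⟩ : ∃ s : FunctionField G, IsGen ℂ s ∧
      ∀ W, IsPlace ℂ W → (s ∈ W ↔ W ≠ V) := by
    refine ⟨r⁻¹, hr.inv, fun W hW => ⟨fun h hWV => ?_, fun h => by_contra fun hn => h ?_⟩⟩
    · exact notMem_of_valuation_inv_lt_one (inv_ne_zero hr.ne_zero) (by rwa [inv_inv]) (hWV ▸ h)
    · exact hW.eq_of_valuation_lt_one hV hr (by simpa using valuation_inv_lt_one hn) hVr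
  obtain ⟨α, β, hα, hαβ⟩ := hs.exists_affine hs.conjFunctionField fun W hW => by
    rw [hsV W hW, ← mem_conjPlace, hsV _ hW.conjPlace]
    refine not_congr ⟨fun h => by rw [h, hconj], fun h => ?_⟩
    rw [← conjPlace_conjPlace W, h, hconj]
  -- the trace of `lam * s` is self-conjugate, and nonconstant for `lam = 1` or `lam = i`
  obtain ⟨lam, hlam⟩ : ∃ lam : ℂ, lam + conj lam * α ≠ 0 := by
    by_cases h1 : 1 + α = 0
    · refine ⟨Complex.I, ?_⟩
      rw [show α = -1 by linear_combination h1, Complex.conj_I]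
      intro h0
      have := congrArg Complex.im h0
      norm_num at this
    · exact ⟨1, by simpa using h1⟩
  obtain ⟨w, hw⟩ : ∃ w, w = algebraMap ℂ (FunctionField G) lam * s +
      conjFunctionField G (algebraMap ℂ (FunctionField G) lam * s) := ⟨_, rfl⟩
  have hwconj : conjFunctionField G w = w := by
    rw [hw, map_add, conjFunctionField_conj, add_comm]
  have hws : w = algebraMap ℂ _ (lam + conj lam * α) * s + algebraMap ℂ _ (conj lam * β) := by
    rw [hw, map_mul, conjFunctionField_algebraMap, hαβ]
    simp only [map_add, map_mul]
    ring
  have hwgen : IsGen ℂ w := hws ▸ hs.affine hlam _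
  have hsw : ∀ W : ValuationSubring (FunctionField G), IsPlace ℂ W → (s ∈ W ↔ w ∈ W) := by
    intro W hW
    constructor
    · intro h
      rw [hws]
      exact W.add_mem _ _ (W.mul_mem _ _ (hW _) h) (hW _)
    · intro h
      have hc : algebraMap ℂ (FunctionField G) (lam + conj lam * α) ≠ 0 := by
        simpa only [ne_eq, map_eq_zero] using hlam
      have : s = algebraMap ℂ _ (lam + conj lam * α)⁻¹ * (w - algebraMap ℂ _ (conj lam * β)) := by
        rw [hws, map_inv₀, add_sub_cancel_right, inv_mul_cancel_left₀ hc]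
      rw [this]
      exact W.mul_mem _ _ (hW _) (sub_mem h (hW _))
  have hcoord : ∀ i, ∃ A : Polynomial ℂ, Polynomial.aeval w A = coord G i := by
    intro i
    refine hwgen.exists_aeval_eq fun W hW hwW => by_contra fun hn => ?_
    have hWV := (hsV W hW).1 ((hsw W hW).2 hwW)
    have hWb : W ∈ branchesAtInfinity G := by
      refine ⟨hW, fun h => hn ?_⟩
      fin_cases i
      · exact h.1
      · exact h.2
    rw [hbr] at hWb
    exact hWV hWb
  have h0 := hj (MvPolynomial.X 0)
  have h1 := hj (MvPolynomial.X 1)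
  rw [toF_X, MvPolynomial.aeval_X] at h0 h1
  obtain ⟨f, hf⟩ : ∃ f, lev ratX f = j w := by
    refine isGen_ratX.exists_lev_eq fun U hU hX hX' => ?_
    have hlp : ∀ P, lev ratX (lp P) ∈ U := fun P => by
      rw [lev_lp]
      refine U.add_mem _ _ (hU.aeval_mem hX P) (hU.aeval_mem ?_ _)
      simpa using hX'
    have hUp : IsPlace ℂ (U.comap (j : FunctionField G →+* RatFunc ℂ)) := hU.comap
    have hne : U.comap (j : FunctionField G →+* RatFunc ℂ) ≠ V := by
      intro he
      rw [← he] at hVb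
      exact hVb.2 ⟨ValuationSubring.mem_comap.2 (h0.symm ▸ hlp P),
        ValuationSubring.mem_comap.2 (h1.symm ▸ hlp Q)⟩
    exact (hsw _ hUp).1 ((hsV _ hUp).2 hne)
  obtain ⟨τ, hτ⟩ := isGen_ratX.exists_conj
  have hinj := lev_injective isGen_ratX.transcendental
  have hfix : lconj f = f := by
    refine hinj ?_
    rw [← hτ, hf, ← conj_comp_functionField hτ hj, hwconj]
  have hcoordL : ∀ i, ∃ A : Polynomial ℂ, ![lp P, lp Q] i = Polynomial.aeval f A := by
    intro i
    obtain ⟨A, hA⟩ := hcoord i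
    refine ⟨A, hinj ?_⟩
    have hi := hj (MvPolynomial.X i)
    rw [toF_X, MvPolynomial.aeval_X] at hi
    rw [← hi, ← hA, ← Polynomial.aeval_algHom_apply, ← Polynomial.aeval_algHom_apply, hf]
  obtain ⟨A, hA⟩ := hcoordL 0
  obtain ⟨B, hB⟩ := hcoordL 1
  obtain ⟨-, -, E, hE, hEinj⟩ := h
  let g : ℝ → ℝ := fun t => (lev (cis t) f).re
  have hg : ∀ t, ((g t : ℝ) : ℂ) = lev (cis t) f := lev_cis_real hfix
  have hrpt : ∀ t, rpt P Q t = ((Polynomial.aeval (g t : ℂ) A).re,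
      (Polynomial.aeval (g t : ℂ) B).re) := by
    intro t
    rw [hg, Polynomial.aeval_algHom_apply, Polynomial.aeval_algHom_apply, ← hA, ← hB]
    rfl
  refine not_injOn_of_periodic (g := g) Real.two_pi_pos
    (Complex.continuous_re.comp (continuous_lev_cis f)) ?_ hE fun t ht t' ht' htt => ?_
  · have : cis 0 = cis (2 * Real.pi) := Units.ext (by simp [cis_val])
    simp only [g, this]
  · refine hEinj ht ht' ?_
    rw [hrpt, hrpt, htt]

omit [IsDomain (CoordRing G)] in
lemma lev_lp_notMem {V : ValuationSubring (RatFunc ℂ)} (hV : IsPlace ℂ V)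
    (h : V.valuation (ratX : RatFunc ℂ) < 1 ∨ V.valuation (ratX : RatFunc ℂ)⁻¹ < 1)
    (hP : P.natDegree ≠ 0) : lev ratX (lp P) ∉ V := by
  have h0 : (ratX : RatFunc ℂ) ≠ 0 := ratX.ne_zero
  intro hmem
  rw [lev_lp, Units.val_inv_eq_inv_val] at hmem
  rcases h with h | h
  · have h1 := hV.aeval_mem (mem_of_valuation_lt_one h) P
    have h2 := hV.aeval_notMem (notMem_of_valuation_inv_lt_one (inv_ne_zero h0) (by rwa [inv_inv]))
      (p := P.map (starRingEnd ℂ)) (by rwa [Polynomial.natDegree_map])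
    exact h2 (by simpa using sub_mem hmem h1)
  · have h1 := hV.aeval_mem (mem_of_valuation_lt_one h) (P.map (starRingEnd ℂ))
    have h2 := hV.aeval_notMem (notMem_of_valuation_inv_lt_one h0 h) hP
    exact h2 (by simpa using sub_mem hmem h1)

lemma comap_mem_branchesAtInfinity
    (hj : ∀ H, j (toF G H) = lev ratX (MvPolynomial.aeval ![lp P, lp Q] H))
    (hPQ : P.natDegree ≠ 0 ∨ Q.natDegree ≠ 0)
    {V : ValuationSubring (RatFunc ℂ)} (hV : IsPlace ℂ V)
    (h : V.valuation (ratX : RatFunc ℂ) < 1 ∨ V.valuation (ratX : RatFunc ℂ)⁻¹ < 1) :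
    V.comap (j : FunctionField G →+* RatFunc ℂ) ∈ branchesAtInfinity G := by
  refine ⟨hV.comap, ?_⟩
  rw [ValuationSubring.mem_comap, ValuationSubring.mem_comap]
  have h0 := hj (MvPolynomial.X 0)
  have h1 := hj (MvPolynomial.X 1)
  rw [toF_X, MvPolynomial.aeval_X] at h0 h1
  rintro ⟨hx, hy⟩
  rcases hPQ with hP | hQ
  · refine lev_lp_notMem hV h hP ?_
    exact (h0 : _ = lev ratX (lp P)) ▸ hx
  · refine lev_lp_notMem hV h hQ ?_
    exact (h1 : _ = lev ratX (lp Q)) ▸ hy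

/-- By Lüroth's theorem the curve is rational. -/
lemma exists_isGen_functionField
    (hj : ∀ H, j (toF G H) = lev ratX (MvPolynomial.aeval ![lp P, lp Q] H))
    (hPQ : P.natDegree ≠ 0 ∨ Q.natDegree ≠ 0) : ∃ s : FunctionField G, IsGen ℂ s := by
  obtain ⟨V, hV, hV0⟩ := exists_place_valuation_lt_one isGen_ratX.transcendental
  have hb := comap_mem_branchesAtInfinity hj hPQ hV (Or.inl hV0)
  have hp := hb.1
  by_cases hx : coord G 0 ∈ V.comap (j : FunctionField G →+* RatFunc ℂ)
  · exact isGen_ratX.exists_isGen_of_algHom j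
      (IsPlace.transcendental_of_notMem hp fun hy => hb.2 ⟨hx, hy⟩)
  · exact isGen_ratX.exists_isGen_of_algHom j (IsPlace.transcendental_of_notMem hp hx)

/-- The places at infinity of the curve lie below `0` and `∞`, which the conjugation `φ ↦ φ⁻¹`
interchanges. -/
lemma exists_branchesAtInfinity_eq
    (h : IsGenericParam (rpt P Q) (Set.Ico 0 (2 * Real.pi)) (points ℝ G))
    (hj : ∀ H, j (toF G H) = lev ratX (MvPolynomial.aeval ![lp P, lp Q] H)) :
    ∃ V : ValuationSubring (FunctionField G),
      V ≠ conjPlace G V ∧ branchesAtInfinity G = {V, conjPlace G V} := by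
  have hPQ := natDegree_ne_zero h
  obtain ⟨s, hs⟩ := exists_isGen_functionField hj hPQ
  obtain ⟨V₀, hV₀, h₀⟩ := exists_place_valuation_lt_one isGen_ratX.transcendental
  obtain ⟨V₁, hV₁, h₁⟩ := exists_place_valuation_lt_one isGen_ratX.inv.transcendental
  obtain ⟨τ, hτ⟩ := isGen_ratX.exists_conj
  have hτc : ∀ c : ℂ, τ (algebraMap ℂ _ c) = algebraMap ℂ _ (conj c) := fun c => by
    have := hτ (C c)
    rwa [lconj_C, C_eq_algebraMap, C_eq_algebraMap, AlgHom.commutes, AlgHom.commutes] at this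
  have hτX : τ (ratX : RatFunc ℂ) = (ratX : RatFunc ℂ)⁻¹ := by
    have := hτ (T 1)
    rw [lconj_T, lev_T, lev_T, zpow_one, zpow_neg, zpow_one] at this
    simpa using this
  have hττ : V₀.comap (τ : RatFunc ℂ →+* RatFunc ℂ) = V₁ := by
    refine IsPlace.eq_of_valuation_lt_one (k := ℂ) (r := (ratX : RatFunc ℂ)⁻¹) (fun c => ?_) hV₁
      isGen_ratX.inv (valuation_inv_lt_one ?_) h₁
    · rw [ValuationSubring.mem_comap]
      exact (hτc c).symm ▸ hV₀ _
    · rw [ValuationSubring.mem_comap]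
      change τ _ ∉ V₀
      rw [hτX]
      exact notMem_of_valuation_inv_lt_one (inv_ne_zero ratX.ne_zero) (by rwa [inv_inv])
  have hconj : conjPlace G (V₀.comap (j : FunctionField G →+* RatFunc ℂ)) =
      V₁.comap (j : FunctionField G →+* RatFunc ℂ) := by
    ext x
    rw [mem_conjPlace, ← hττ, ValuationSubring.mem_comap, ValuationSubring.mem_comap,
      ValuationSubring.mem_comap]
    exact iff_of_eq (congrArg (· ∈ V₀) (conj_comp_functionField hτ hj x))
  have hbr : branchesAtInfinity G = {V₀.comap (j : FunctionField G →+* RatFunc ℂ),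
      conjPlace G (V₀.comap (j : FunctionField G →+* RatFunc ℂ))} := by
    rw [hconj]
    refine Set.Subset.antisymm
      (fun W hW => eq_comap_or_eq_comap hj hV₀ hV₁ h₀ h₁ hs hW) ?_
    rintro _ (rfl | rfl)
    · exact comap_mem_branchesAtInfinity hj hPQ hV₀ (Or.inl h₀)
    · exact comap_mem_branchesAtInfinity hj hPQ hV₁ (Or.inr h₁)
  refine ⟨_, fun heq => ?_, hbr⟩
  rw [← heq, Set.pair_eq_singleton] at hbr
  exact not_subsingleton_branches h hj hbr heq.symm hs

end

end

end TrigCurve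

end

theorem mainTheorem9 (G : MvPolynomial (Fin 2) ℝ) (hG : Squarefree G) (hG' : ¬ IsUnit G)
    (hvis : ∀ H : MvPolynomial (Fin 2) ℝ, Irreducible H → H ∣ G →
      (TrigCurve.points ℝ H).Finite → Associated H G) :
    List.TFAE [
      TrigCurve.IsTrigonometric G,
      ∃ P Q : Polynomial ℂ,
        TrigCurve.IsGenericParam
          (fun φ : ℂ => (TrigCurve.laurentEval P φ, TrigCurve.laurentEval Q φ))
          {φ : ℂ | φ ≠ 0} (TrigCurve.points ℂ G),
      TrigCurve.IsRational G ∧ TrigCurve.HasTwoConjBranchesAtInfinity G ∧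
        (TrigCurve.points ℝ G).Infinite] := by
  have hG0 : G ≠ 0 := hG.ne_zero
  tfae_have 2 → 1 := by
    rintro ⟨P, Q, h⟩
    exact TrigCurve.isTrigonometric_of_lpt (TrigCurve.isGenericParam_lpt_iff.1 h)
  tfae_have 1 → 3 := by
    rintro ⟨X, Y, hX, hY, h⟩
    obtain ⟨P, hP⟩ := hX.exists_lp
    obtain ⟨Q, hQ⟩ := hY.exists_lp
    have hXY : (fun t => (X t, Y t)) = TrigCurve.rpt P Q := by
      funext t
      rw [TrigCurve.rpt, ← hP, ← hQ, Complex.ofReal_re, Complex.ofReal_re]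
    rw [hXY] at h
    have hirr := TrigCurve.irreducible_of_isGenericParam h hG hvis
    have hker := fun H => TrigCurve.aeval_lp_eq_zero_iff h hirr (H := H)
    have hdom := TrigCurve.isDomain_coordRing hker
    obtain ⟨j, hj⟩ := TrigCurve.exists_functionField_algHom hker
    obtain ⟨s, hs⟩ := TrigCurve.exists_isGen_functionField hj (TrigCurve.natDegree_ne_zero h)
    obtain ⟨e⟩ := hs.nonempty_algEquiv
    exact ⟨⟨hdom, ⟨e.symm⟩⟩, ⟨hdom, TrigCurve.exists_branchesAtInfinity_eq h hj⟩,
      (TrigCurve.infinite_image_rpt h).mono h.mapsTo.image_subset⟩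
  tfae_have 3 → 2 := by
    rintro ⟨⟨hdom, ⟨e⟩⟩, ⟨_, V, hne, hbr⟩, hinf⟩
    obtain ⟨u, P, Q, hu, hP, hQ⟩ := TrigCurve.exists_lp_eq_coord hG0 hinf hne hbr
      (TrigCurve.isGen_of_algEquiv e.symm)
    exact ⟨P, Q, TrigCurve.isGenericParam_lpt_iff.2
      (TrigCurve.isGenericParam_of_lev_eq_coord hG0 hu hP hQ)⟩
  tfae_finish
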